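/- Represent $\mathbb{RP}^3$ as the ball $D^3$ with antipodal boundary points identified; in homogeneous coordinates $[x:y:z:w]$ the boundary sphere is $\{w=0\}$, both poles of the ball give the point $[0:0:1:0]$, and the projection along the circles through the poles onto the equatorial disk $D^2$ (with antipodal boundary points identified, i.e. onto $\mathbb{RP}^2$ with the line at infinity $\{w=0\}$) is $[x:y:z:w]\mapsto[x:y:w]$. A knot is a smoothly embedded circle in $\mathbb{RP}^3$. A knot diagram $D$ is a smooth generic immersion of one circle in $\mathbb{RP}^2$ (finitely many multiple points, all of them transverse double points lying off the line at infinity; the curve is transverse to the line at infinity), together with the choice, at each double point (crossing), of one of the two branches as the overpass, the other being the underpass. $D$ is a diagram of a knot $K$ if $K$ misses the pole, projects to the curve of $D$, and at each crossing the overpass is the branch coming from the point of $K$ closer to the north pole, i.e. with the larger $z/w$. A knot is an unknot if it is ambient isotopic in $\mathbb{RP}^3$ to a planar circle or to a projective line. A crossing change at a crossing exchanges its overpass and underpass. A basepoint is a point of the diagram that is neither a crossing nor on the line at infinity. A diagram with an orientation and a basepoint is descending if for every crossing, travelling from the basepoint along the orientation, the first pass through the crossing is an overpass when the line at infinity has been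 crossed an even number of times before it, and an underpass when it has been crossed an odd number of times. Corollary. Let $D$ be a diagram of a knot in $\mathbb{RP}^3$. By finitely many crossing changes $D$ can be turned into a diagram of an unknot. More precisely, for every choice of an orientation and a basepoint of $D$ there is a finite set of crossings of $D$ such that the diagram obtained by changing these crossings is descending with respect to the chosen orientation and basepoint, and this diagram is a diagram of an unknot. -/

import Mathlib

open scoped ContDiff

noncomputable section

namespace ProjKnot

/-! ### Projective spaces, smooth closed curves, ambient isotopy -/

/-- Real projective `n`-space, with homogeneous coordinates indexed by `Fin (n + 1)`. -/
abbrev RP (n : ℕ) : Type := Projectivization ℝ (Fin (n + 1) → ℝ)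

/-- The usual topology of `RP n`: the quotient topology from `ℝ^(n+1) \ {0}`. -/
instance instTopologicalSpaceRP (n : ℕ) : TopologicalSpace (RP n) :=
  inferInstanceAs (TopologicalSpace (Quotient (projectivizationSetoid ℝ (Fin (n + 1) → ℝ))))

/-- `F` expresses the closed curve `c` in smooth homogeneous coordinates. As `ℝ` is simply
connected, the smooth maps from the circle `ℝ / ℤ` to `RP n` are the `c` that have such an `F`.
The lift `F` is not assumed periodic (for a noncontractible curve it cannot be). -/
def IsSmoothLift {n : ℕ} (F : ℝ → (Fin (n + 1) → ℝ)) (c : UnitAddCircle → RP n) : Prop :=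
  ContDiff ℝ ∞ F ∧
    ∀ t : ℝ, ∃ h : F t ≠ 0, c (t : UnitAddCircle) = Projectivization.mk ℝ (F t) h

/-- `c` is a smooth immersion of the circle in `RP n`. In homogeneous coordinates `F`, the
velocity of the curve is nonzero exactly when `F` and its derivative are linearly independent. -/
def IsSmoothImmersion {n : ℕ} (c : UnitAddCircle → RP n) : Prop :=
  ∃ F, IsSmoothLift F c ∧ ∀ t : ℝ, LinearIndependent ℝ ![F t, deriv F t]

/-- A (parametrized, smooth) knot in `RP 3`: a smooth embedding of the circle. As the circle is
compact, an embedding is an injective immersion. -/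
structure Knot where
  toFun : UnitAddCircle → RP 3
  smooth : IsSmoothImmersion toFun
  injective : Function.Injective toFun

/-- Two subsets of a space are ambient isotopic. -/
def AmbientIsotopic {X : Type*} [TopologicalSpace X] (A B : Set X) : Prop :=
  ∃ H : unitInterval → X ≃ₜ X,
    Continuous (fun p : unitInterval × X => H p.1 p.2) ∧
      H 0 = Homeomorph.refl X ∧ H 1 '' A = B

/-- The planar circle `x² + y² = 1`, `z = 0` of `RP 3`, in homogeneous coordinates
`[x : y : z : w]`. -/
def planarCircle : Set (RP 3) :=
  {Q | Q.rep 0 ^ 2 + Q.rep 1 ^ 2 = Q.rep 3 ^ 2 ∧ Q.rep 2 = 0}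

/-- The projective line `y = z = 0` of `RP 3`. -/
def projectiveLine : Set (RP 3) :=
  {Q | Q.rep 1 = 0 ∧ Q.rep 2 = 0}

/-- There are two unknots in `RP 3` up to isotopy: a planar circle and a projective line. -/
def Knot.IsUnknot (K : Knot) : Prop :=
  AmbientIsotopic (Set.range K.toFun) planarCircle ∨
    AmbientIsotopic (Set.range K.toFun) projectiveLine

/-! ### Projection to the equatorial disk

`RP 3` is the unit ball with antipodal boundary points identified: the point `[x : y : z : w]`
with `w ≥ 0` and `x² + y² + z² + w² = 1` corresponds to the point `(x, y, z) / (1 + w)` of the ball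
(stereographic projection of a half-sphere). The two poles `(0, 0, ±1)` of the ball give the point
`[0 : 0 : 1 : 0]`, the boundary of the ball is `w = 0`, and the circles through the two poles are
the projective lines through `[0 : 0 : 1 : 0]`. So the equatorial disk, with antipodal boundary
points identified, is the projective plane with homogeneous coordinates `[x : y : w]`, its boundary
circle gives the line at infinity `w = 0`, and the projection along the circles through the poles
is `[x : y : z : w] ↦ [x : y : w]`. -/

/-- The line at infinity `w = 0` in the projective plane with coordinates `[x : y : w]`. -/
def lineAtInfinity : Set (RP 2) := {P | P.rep 2 = 0}

/-- The point `Q` of `RP 3` is not the pole, and it is projected to `P`. -/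
def ProjectsTo (Q : RP 3) (P : RP 2) : Prop :=
  ∃ (v : Fin 4 → ℝ) (hv : v ≠ 0) (hv' : ![v 0, v 1, v 3] ≠ 0),
    Q = Projectivization.mk ℝ v hv ∧ P = Projectivization.mk ℝ ![v 0, v 1, v 3] hv'

/-- The height `z / w` of a point `[x : y : z : w]` with `w ≠ 0`. On the arc from the north pole to
the south pole over an interior point of the disk it decreases from `+∞` to `-∞`. -/
def height (Q : RP 3) : ℝ := Q.rep 2 / Q.rep 3

/-! ### Knot diagrams -/

/-- The double points of a closed curve in the projective plane. -/
def doublePoints (c : UnitAddCircle → RP 2) : Set (RP 2) :=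
  {P | ∃ s t, s ≠ t ∧ c s = P ∧ c t = P}

/-- A generic immersion of the circle in the projective plane with its line at infinity. -/
structure IsGeneric (c : UnitAddCircle → RP 2) : Prop where
  /-- `c` is a smooth immersion; two branches through the same point have different tangent lines;
  and `c` is transverse to the line at infinity. -/
  exists_lift : ∃ F, IsSmoothLift F c ∧
    (∀ t : ℝ, LinearIndependent ℝ ![F t, deriv F t]) ∧
    (∀ s t : ℝ, (s : UnitAddCircle) ≠ t → c s = c t →
      LinearIndependent ℝ ![F s, deriv F s, deriv F t]) ∧
    ∀ t : ℝ, F t 2 = 0 → deriv F t 2 ≠ 0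
  /-- There are finitely many double points. -/
  finite_doublePoints : (doublePoints c).Finite
  /-- There are no triple points. -/
  no_triple : ∀ r s t, c r = c s → c s = c t → r = s ∨ s = t ∨ r = t
  /-- The double points are in the interior of the disk. -/
  notMem_lineAtInfinity : ∀ P ∈ doublePoints c, P ∉ lineAtInfinity

/-- A diagram of a knot in `RP 3`. Its arcs in the disk are the pieces in which the line at infinity
cuts the closed curve `curve`. The parameters `t` for which `curve t` is a double point are the
branches of the crossings; `overpasses` is the set of those that are overpasses. -/
@[ext]
structure KnotDiagram where
  curve : UnitAddCircle → RP 2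
  generic : IsGeneric curve
  overpasses : Set UnitAddCircle
  overpasses_subset : ∀ t ∈ overpasses, curve t ∈ doublePoints curve
  /-- Of the two branches of a crossing exactly one is the overpass. -/
  overpasses_iff : ∀ s t, s ≠ t → curve s = curve t → (s ∈ overpasses ↔ t ∉ overpasses)

namespace KnotDiagram

/-- The crossings of a diagram. -/
def crossings (D : KnotDiagram) : Set (RP 2) := doublePoints D.curve

/-- `D` is a diagram of the knot `K`: the knot is projected to the curve of `D`, and at each
crossing the overpass is the branch that comes from the higher point of the knot. -/
def IsDiagramOf (D : KnotDiagram) (K : Knot) : Prop :=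
  (∀ t, ProjectsTo (K.toFun t) (D.curve t)) ∧
    ∀ s t, s ≠ t → D.curve s = D.curve t →
      (s ∈ D.overpasses ↔ height (K.toFun t) < height (K.toFun s))

/-- `D` is a diagram of an unknot. -/
def IsDiagramOfUnknot (D : KnotDiagram) : Prop :=
  ∃ K : Knot, D.IsDiagramOf K ∧ K.IsUnknot

/-- The diagram obtained from `D` by the crossing changes at the crossings in `S`. -/
def changeCrossings (D : KnotDiagram) (S : Set (RP 2)) : KnotDiagram where
  curve := D.curve
  generic := D.generic
  overpasses := {t | D.curve t ∈ D.crossings ∧ (t ∈ D.overpasses ↔ D.curve t ∉ S)}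
  overpasses_subset := fun _ ht => ht.1
  overpasses_iff := by
    intro s t hst h
    have hx := D.overpasses_iff s t hst h
    have hs : D.curve s ∈ D.crossings := ⟨s, t, hst, rfl, h.symm⟩
    have ht : D.curve t ∈ D.crossings := h ▸ hs
    simp only [Set.mem_ofPred_eq, hs, ht, true_and]
    rw [h]
    tauto

/-- A basepoint: a point of the diagram, distinct from the crossings and the endpoints of arcs. -/
def IsBasepoint (D : KnotDiagram) (b : UnitAddCircle) : Prop :=
  D.curve b ∉ D.crossings ∧ D.curve b ∉ lineAtInfinity

/-- The position after time `τ` of a traveller along the circle who starts at `b` and goes in the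
direction `o = 1` or `o = -1`; one turn takes the time `1`. -/
def travel (o : ℤˣ) (b : UnitAddCircle) (τ : ℝ) : UnitAddCircle :=
  b + (o : ℤ) • (τ : UnitAddCircle)

/-- The arc distance from `b` to the point that is reached from `b` after time `τ < 1`: the number
of times the line at infinity is crossed on the way. -/
def arcDistance (D : KnotDiagram) (o : ℤˣ) (b : UnitAddCircle) (τ : ℝ) : ℕ :=
  {σ : ℝ | σ ∈ Set.Ioo 0 τ ∧ D.curve (travel o b σ) ∈ lineAtInfinity}.ncard

/-- The diagram `D` with the orientation `o` and the basepoint `b` is descending: if a crossing is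
passed for the first time after time `σ` (and again after time `τ`), then this first pass is an
overpass when its arc distance from the basepoint is even, and an underpass when it is odd. -/
def IsDescending (D : KnotDiagram) (o : ℤˣ) (b : UnitAddCircle) : Prop :=
  ∀ σ τ : ℝ, 0 < σ → σ < τ → τ < 1 →
    D.curve (travel o b σ) = D.curve (travel o b τ) →
      (Even (D.arcDistance o b σ) → travel o b σ ∈ D.overpasses) ∧
        (Odd (D.arcDistance o b σ) → travel o b σ ∉ D.overpasses)

end KnotDiagram

end ProjKnot

end

noncomputable section

namespace ProjKnot

/-! ### Isotopies of projective spaces given in homogeneous coordinates -/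

/-! In the traveller's time `t`, the curve of `D` lifts to unit vectors `G t` of `ℝ³` with `G (t +
1) = ε • G t`, `ε = ±1` (`exists_isUnitLift`, `exists_period`). A height function `z` with the same
`ε` gives a closed curve `withHeight (G t) (z t)` in `RP 3`. All crossings are passed before some
time `τ < 1`, so a reparametrization `ρ` of the circle fixing the basepoint moves all of them into
`(0, 1/2)`. The knot has `z = ζ ∘ ρ`, where `ζ` is even, and positive and strictly decreasing on
`(0, 1/2)`: `1 / √(5 - 4 cos 2πu)` for `ε = 1` and `cos πu` for `ε = -1`.

Descending: at a crossing passed at times `s < t` one has `G t = e • G s` with `e = ±1`, so the two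
heights are `ζ (ρ s)` and `e * ζ (ρ t)` divided by the same number `G s 2`. The first numerator is
larger, hence the first pass is over exactly when `G s 2 > 0`. The last coordinate of `G` is
positive at the basepoint and has only simple zeros, so its sign is the parity of the arc distance
(`even_ncard_zeros_iff`).

Unknotted: put `F = G ∘ ρ.symm`. The levels of the ratio `|z| : |(x, y, w)|` meet the knot only in
pairs of points with parameters `u` and `-u`, `0 ≤ u ≤ 1/2`. There are no crossings with parameter
in `(1/2, 1)`, so `F u` and `F (-u)` are independent for `0 < u < 1/2`; at the two ends the
immersion supplies the independent vectors `F u`, `F' u`. This gives a continuous frame `B u` in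
which the two points have the coordinates `(a, b, 0)` and `(a, -b, 0)` of a model plane curve
(`exists_frame`). Applying `B⁻¹` level by level is the end of an ambient isotopy (`exists_twist`),
which flattens the knot to a planar circle or a line up to signs of coordinates. A linear isotopy
finishes the proof. -/

theorem isOpenQuotientMap_mk' (n : ℕ) :
    IsOpenQuotientMap (Projectivization.mk' ℝ : {v : Fin (n + 1) → ℝ // v ≠ 0} → RP n) := by
  refine ⟨fun Q => ⟨⟨Q.rep, Q.rep_nonzero⟩, Q.mk_rep⟩, continuous_coinduced_rng, ?_⟩
  intro W hW
  refine isOpen_coinduced.2 ?_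
  -- The saturation of an open set is the union of its multiples by units, hence open.
  have key : (Projectivization.mk' ℝ : {v : Fin (n + 1) → ℝ // v ≠ 0} → RP n) ⁻¹'
      (Projectivization.mk' ℝ '' W) =
      ⋃ a : ℝˣ, (fun v : {v : Fin (n + 1) → ℝ // v ≠ 0} =>
        (⟨a • v.1, (smul_ne_zero_iff_ne a).2 v.2⟩ : {v : Fin (n + 1) → ℝ // v ≠ 0})) ⁻¹' W := by
    ext ⟨v, hv⟩
    simp only [Set.mem_preimage, Set.mem_image, Set.mem_iUnion]
    constructor
    · rintro ⟨⟨w, hw⟩, hwW, h⟩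
      obtain ⟨a, ha⟩ := (Projectivization.mk_eq_mk_iff ℝ w v hw hv).1 h
      refine ⟨a, ?_⟩
      convert hwW
    · rintro ⟨a, ha⟩
      exact ⟨_, ha, (Projectivization.mk_eq_mk_iff ℝ _ v _ hv).2 ⟨a, rfl⟩⟩
  change IsOpen ((Projectivization.mk' ℝ : {v : Fin (n + 1) → ℝ // v ≠ 0} → RP n) ⁻¹'
      (Projectivization.mk' ℝ '' W))
  rw [key]
  refine isOpen_iUnion fun a => hW.preimage ?_
  exact Continuous.subtype_mk (continuous_subtype_val.const_smul a) _

/-- The self-map of `RP n` with a given expression in homogeneous coordinates. -/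
def projMap {n : ℕ} (Φ : (Fin (n + 1) → ℝ) → (Fin (n + 1) → ℝ))
    (h0 : ∀ v, v ≠ 0 → Φ v ≠ 0) (hc : ∀ (c : ℝ) v, c ≠ 0 → Φ (c • v) = c • Φ v) :
    RP n → RP n :=
  Projectivization.lift (fun v => Projectivization.mk ℝ (Φ v.1) (h0 _ v.2)) (by
    rintro ⟨a, ha⟩ ⟨b, hb⟩ t (rfl : a = t • b)
    have ht : t ≠ 0 := by rintro rfl; simp at ha
    exact (Projectivization.mk_eq_mk_iff' ℝ _ _ _ _).2 ⟨t, (hc t b ht).symm⟩)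

/-- A product of quotient maps need not be a quotient map, but a product of open ones is. So
continuity, jointly with the parameter, can be tested on nonzero vectors. -/
theorem continuous_projMap {n : ℕ} {X : Type*} [TopologicalSpace X]
    (Φ : X → (Fin (n + 1) → ℝ) → (Fin (n + 1) → ℝ))
    (h0 : ∀ s v, v ≠ 0 → Φ s v ≠ 0) (hc : ∀ s (c : ℝ) v, c ≠ 0 → Φ s (c • v) = c • Φ s v)
    (hΦ : ∀ s v, v ≠ 0 → ContinuousAt (fun p : X × (Fin (n + 1) → ℝ) => Φ p.1 p.2) (s, v)) :
    Continuous fun p : X × RP n => projMap (Φ p.1) (h0 p.1) (hc p.1) p.2 := by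
  have hq := (IsOpenQuotientMap.id (X := X)).prodMap (isOpenQuotientMap_mk' n)
  refine hq.isQuotientMap.continuous_iff.2 ?_
  change Continuous fun p : X × {v : Fin (n + 1) → ℝ // v ≠ 0} =>
    Projectivization.mk' ℝ ⟨Φ p.1 p.2.1, h0 _ _ p.2.2⟩
  refine (isOpenQuotientMap_mk' n).continuous.comp (Continuous.subtype_mk ?_ _)
  refine continuous_iff_continuousAt.2 fun p => ?_
  exact (hΦ p.1 p.2.1 p.2.2).comp (f := fun p : X × {v : Fin (n + 1) → ℝ // v ≠ 0} => (p.1, p.2.1))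
    (by fun_prop)

/-- An isotopy of `RP n`, given by mutually inverse families of homogeneous maps. -/
theorem exists_isotopy {n : ℕ} (Φ Ψ : unitInterval → (Fin (n + 1) → ℝ) → (Fin (n + 1) → ℝ))
    (hΦ0 : ∀ s v, v ≠ 0 → Φ s v ≠ 0) (hΨ0 : ∀ s v, v ≠ 0 → Ψ s v ≠ 0)
    (hΦc : ∀ s (c : ℝ) v, c ≠ 0 → Φ s (c • v) = c • Φ s v)
    (hΨc : ∀ s (c : ℝ) v, c ≠ 0 → Ψ s (c • v) = c • Ψ s v)
    (hΦ : ∀ s v, v ≠ 0 →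
      ContinuousAt (fun p : unitInterval × (Fin (n + 1) → ℝ) => Φ p.1 p.2) (s, v))
    (hΨ : ∀ s v, v ≠ 0 →
      ContinuousAt (fun p : unitInterval × (Fin (n + 1) → ℝ) => Ψ p.1 p.2) (s, v))
    (hΨΦ : ∀ s v, v ≠ 0 → Ψ s (Φ s v) = v) (hΦΨ : ∀ s v, v ≠ 0 → Φ s (Ψ s v) = v)
    (hid : ∀ v, Φ 0 v = v) :
    ∃ H : unitInterval → RP n ≃ₜ RP n,
      Continuous (fun p : unitInterval × RP n => H p.1 p.2) ∧ H 0 = Homeomorph.refl _ ∧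
      ∀ s v hv, H s (Projectivization.mk ℝ v hv) = Projectivization.mk ℝ (Φ s v) (hΦ0 s v hv) := by
  have cΦ := continuous_projMap Φ hΦ0 hΦc hΦ
  have cΨ := continuous_projMap Ψ hΨ0 hΨc hΨ
  refine ⟨fun s =>
    { toFun := projMap (Φ s) (hΦ0 s) (hΦc s)
      invFun := projMap (Ψ s) (hΨ0 s) (hΨc s)
      left_inv := ?_
      right_inv := ?_
      continuous_toFun := cΦ.comp (Continuous.prodMk_right s)
      continuous_invFun := cΨ.comp (Continuous.prodMk_right s) }, cΦ, ?_, fun _ _ _ => rfl⟩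
  · intro Q
    induction Q using Projectivization.ind with | h v hv => ?_
    simp only [projMap, Projectivization.lift_mk, hΨΦ s v hv]
  · intro Q
    induction Q using Projectivization.ind with | h v hv => ?_
    simp only [projMap, Projectivization.lift_mk, hΦΨ s v hv]
  · ext Q
    induction Q using Projectivization.ind with | h v hv => ?_
    simp [projMap, hid]

/-- The subset of `RP n` formed by the points with homogeneous coordinates in `P`. -/
def pointsOf {n : ℕ} (P : Set (Fin (n + 1) → ℝ)) : Set (RP n) :=
  {Q | ∃ (v : Fin (n + 1) → ℝ) (hv : v ≠ 0), v ∈ P ∧ Q = Projectivization.mk ℝ v hv}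

/-- The sets of vectors need not be stable under scaling, so both inclusions are tested up to a
scalar. -/
theorem ambientIsotopic_pointsOf {n : ℕ} {P P' : Set (Fin (n + 1) → ℝ)}
    {H : unitInterval → RP n ≃ₜ RP n}
    (hH : Continuous (fun p : unitInterval × RP n => H p.1 p.2)) (H0 : H 0 = Homeomorph.refl _)
    {φ : (Fin (n + 1) → ℝ) → (Fin (n + 1) → ℝ)} (hφ0 : ∀ v, v ≠ 0 → φ v ≠ 0)
    (H1 : ∀ v hv, H 1 (Projectivization.mk ℝ v hv) = Projectivization.mk ℝ (φ v) (hφ0 v hv))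
    (h : ∀ v ∈ P, v ≠ 0 → ∃ c : ℝ, c ≠ 0 ∧ c • φ v ∈ P')
    (h' : ∀ w ∈ P', w ≠ 0 → ∃ v ∈ P, v ≠ 0 ∧ ∃ c : ℝ, c • w = φ v) :
    AmbientIsotopic (pointsOf P) (pointsOf P') := by
  refine ⟨H, hH, H0, Set.Subset.antisymm ?_ ?_⟩
  · rintro _ ⟨_, ⟨v, hv, hP, rfl⟩, rfl⟩
    obtain ⟨c, hc, hcP⟩ := h v hP hv
    refine ⟨_, smul_ne_zero hc (hφ0 v hv), hcP, ?_⟩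
    rw [H1]
    refine ((Projectivization.mk_eq_mk_iff' ℝ _ _ _ _).2 ⟨c, rfl⟩).symm
  · rintro _ ⟨w, hw, hP, rfl⟩
    obtain ⟨v, hvP, hv, c, hc⟩ := h' w hP hw
    refine ⟨_, ⟨v, hv, hvP, rfl⟩, ?_⟩
    rw [H1]
    exact (Projectivization.mk_eq_mk_iff' ℝ _ _ _ _).2 ⟨c, hc⟩

theorem AmbientIsotopic.trans {X : Type*} [TopologicalSpace X] {A B C : Set X}
    (h₁ : AmbientIsotopic A B) (h₂ : AmbientIsotopic B C) : AmbientIsotopic A C := by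
  obtain ⟨H, hH, H0, rfl⟩ := h₁
  obtain ⟨G, hG, G0, rfl⟩ := h₂
  refine ⟨fun s => (H s).trans (G s), ?_, by simp only [H0, G0]; rfl, by rw [Set.image_image]; rfl⟩
  exact hG.comp (continuous_fst.prodMk hH)

/-! ### Linear isotopies -/

/-- Every invertible real matrix is joined to a diagonal matrix with entries `±1` by a path of
invertible matrices. -/
theorem exists_path_to_signs {m : Type*} [Fintype m] [DecidableEq m] (M : Matrix m m ℝ)
    (hM : M.det ≠ 0) :
    ∃ C : unitInterval → Matrix m m ℝ, Continuous C ∧ C 0 = M ∧ (∀ s, (C s).det ≠ 0) ∧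
      ∃ d : m → ℝ, (∀ i, d i * d i = 1) ∧ C 1 = Matrix.diagonal d := by
  refine Matrix.diagonal_transvection_induction_of_det_ne_zero
    (fun M => ∃ C : unitInterval → Matrix m m ℝ, Continuous C ∧ C 0 = M ∧
      (∀ s, (C s).det ≠ 0) ∧ ∃ d : m → ℝ, (∀ i, d i * d i = 1) ∧ C 1 = Matrix.diagonal d)
    M hM ?_ ?_ ?_
  -- Each diagonal entry moves straight to its sign without meeting zero. For a transvection the
  -- off-diagonal entry is shrunk to zero, and for products the paths are multiplied pointwise.
  · intro D hD
    rw [Matrix.det_diagonal, Finset.prod_ne_zero_iff] at hD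
    have hD' : ∀ i, D i ≠ 0 := fun i => hD i (Finset.mem_univ i)
    refine ⟨fun s => Matrix.diagonal fun i => (1 - (s : ℝ)) * D i + s * (D i / |D i|), ?_, ?_, ?_,
      fun i => D i / |D i|, ?_, ?_⟩
    · refine Continuous.matrix_diagonal ?_
      fun_prop
    · simp
    · intro s
      rw [Matrix.det_diagonal, Finset.prod_ne_zero_iff]
      intro i _
      have h : (1 - (s : ℝ)) * D i + s * (D i / |D i|) = D i * ((1 - (s : ℝ)) + s * |D i|⁻¹) := by
        ring
      rw [h]
      refine mul_ne_zero (hD' i) (ne_of_gt ?_)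
      have h1 := s.2.1
      have h2 := s.2.2
      have h3 : 0 < |D i|⁻¹ := inv_pos.2 (abs_pos.2 (hD' i))
      rcases h1.eq_or_lt with h | h
      · rw [← h]; simp
      · have := mul_pos h h3
        linarith
    · intro i
      have h := hD' i
      rw [div_mul_div_comm, abs_mul_abs_self, div_self (mul_ne_zero h h)]
    · simp
  · rintro ⟨i, j, hij, c⟩
    refine ⟨fun s => Matrix.transvection i j ((1 - (s : ℝ)) * c), ?_, ?_, ?_, fun _ => 1, ?_, ?_⟩
    · unfold Matrix.transvection
      refine continuous_const.add ?_
      refine continuous_matrix fun a b => ?_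
      simp only [Matrix.single_apply]
      split_ifs <;> fun_prop
    · simp [Matrix.TransvectionStruct.toMatrix]
    · intro s
      rw [Matrix.det_transvection_of_ne _ _ hij]
      exact one_ne_zero
    · simp
    · simp
  · rintro A B hA hB ⟨C, hC, C0, hC', d, hd, C1⟩ ⟨C', hc, c0, hc', d', hd', c1⟩
    refine ⟨fun s => C s * C' s, hC.matrix_mul hc, by simp [C0, c0], fun s => ?_,
      fun i => d i * d' i, fun i => ?_, ?_⟩
    · rw [Matrix.det_mul]; exact mul_ne_zero (hC' s) (hc' s)
    · linear_combination d' i * d' i * hd i + hd' i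
    · simp [C1, c1]

theorem continuousAt_matrix_inv {m X : Type*} [Fintype m] [DecidableEq m] [TopologicalSpace X]
    {C : X → Matrix m m ℝ} {x : X} (hC : ContinuousAt C x) (h : (C x).det ≠ 0) :
    ContinuousAt (fun y => (C y)⁻¹) x := by
  simp only [Matrix.inv_def, Ring.inverse_eq_inv]
  have h1 : ContinuousAt (fun y => (C y).det) x :=
    (Continuous.matrix_det continuous_id).continuousAt.comp hC
  have h2 : ContinuousAt (fun y => (C y).adjugate) x :=
    (Continuous.matrix_adjugate continuous_id).continuousAt.comp hC
  exact (h1.inv₀ h).smul h2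

/-- The isotopy is `C s * N⁻¹` with `C` a path from `N` to a sign matrix. The sign of a determinant
is constant along such a path, so the identity cannot always be reached; the invariance `hP` absorbs
the remaining signs. -/
theorem ambientIsotopic_image_mulVec {n : ℕ} (N : Matrix (Fin (n + 1)) (Fin (n + 1)) ℝ)
    (hN : N.det ≠ 0) (P : Set (Fin (n + 1) → ℝ))
    (hP : ∀ d : Fin (n + 1) → ℝ, (∀ i, d i * d i = 1) → ∀ v ∈ P, d * v ∈ P) :
    AmbientIsotopic (pointsOf (N.mulVec '' P)) (pointsOf P) := by
  obtain ⟨C, hC, C0, hdet, d, hd, C1⟩ := exists_path_to_signs N hN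
  have hNu : IsUnit N.det := hN.isUnit
  have hCu : ∀ s, IsUnit (C s).det := fun s => (hdet s).isUnit
  have inv1 : ∀ s (v : Fin (n + 1) → ℝ), (N * (C s)⁻¹).mulVec ((C s * N⁻¹).mulVec v) = v := by
    intro s v
    rw [Matrix.mulVec_mulVec, Matrix.mul_assoc, ← Matrix.mul_assoc (C s)⁻¹,
      Matrix.nonsing_inv_mul _ (hCu s), Matrix.one_mul, Matrix.mul_nonsing_inv _ hNu,
      Matrix.one_mulVec]
  have inv2 : ∀ s (v : Fin (n + 1) → ℝ), (C s * N⁻¹).mulVec ((N * (C s)⁻¹).mulVec v) = v := by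
    intro s v
    rw [Matrix.mulVec_mulVec, Matrix.mul_assoc, ← Matrix.mul_assoc N⁻¹,
      Matrix.nonsing_inv_mul _ hNu, Matrix.one_mul, Matrix.mul_nonsing_inv _ (hCu s),
      Matrix.one_mulVec]
  have ne1 : ∀ s (v : Fin (n + 1) → ℝ), v ≠ 0 → (C s * N⁻¹).mulVec v ≠ 0 := by
    intro s v hv h
    exact hv (by rw [← inv1 s v, h, Matrix.mulVec_zero])
  have ne2 : ∀ s (v : Fin (n + 1) → ℝ), v ≠ 0 → (N * (C s)⁻¹).mulVec v ≠ 0 := by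
    intro s v hv h
    exact hv (by rw [← inv2 s v, h, Matrix.mulVec_zero])
  have hCinv : Continuous fun s => (C s)⁻¹ :=
    continuous_iff_continuousAt.2 fun s => continuousAt_matrix_inv hC.continuousAt (hdet s)
  obtain ⟨H, hH, H0, H1⟩ := exists_isotopy
    (fun s v => (C s * N⁻¹).mulVec v) (fun s v => (N * (C s)⁻¹).mulVec v) ne1 ne2
    (fun s c v _ => Matrix.mulVec_smul _ _ _) (fun s c v _ => Matrix.mulVec_smul _ _ _)
    (fun s v _ => (Continuous.matrix_mulVec ((hC.comp continuous_fst).matrix_mul continuous_const)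
      continuous_snd).continuousAt)
    (fun s v _ => (Continuous.matrix_mulVec (continuous_const.matrix_mul
      (hCinv.comp continuous_fst)) continuous_snd).continuousAt)
    (fun s v _ => inv1 s v) (fun s v _ => inv2 s v)
    (fun v => by rw [C0, Matrix.mul_nonsing_inv _ hNu, Matrix.one_mulVec])
  have key : ∀ v, (C 1 * N⁻¹).mulVec (N.mulVec v) = d * v := by
    intro v
    rw [Matrix.mulVec_mulVec, Matrix.mul_assoc, Matrix.nonsing_inv_mul _ hNu, Matrix.mul_one, C1]
    ext i
    simp [Matrix.mulVec_diagonal]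
  refine ambientIsotopic_pointsOf hH H0 (ne1 1) (H1 1) ?_ ?_
  · rintro _ ⟨v, hv, rfl⟩ -
    exact ⟨1, one_ne_zero, by rw [one_smul, key]; exact hP d hd v hv⟩
  · intro w hw hw0
    have hdw : d * (d * w) = w := by
      ext i
      simp only [Pi.mul_apply]
      rw [← mul_assoc, hd, one_mul]
    refine ⟨N.mulVec (d * w), ⟨_, hP d hd w hw, rfl⟩, fun h => hw0 ?_, 1, ?_⟩
    · rw [← hdw, ← key, h, Matrix.mulVec_zero]
    · rw [one_smul]
      exact ((key _).trans hdw).symm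

/-! ### Twists of `RP 3` along concentric spheres -/

/-- The Euclidean norm of `ℝ³`. -/
def nrm (x : Fin 3 → ℝ) : ℝ := √(x 0 ^ 2 + x 1 ^ 2 + x 2 ^ 2)

/-- The vector `(x, y, z, w)` over the vector `(x, y, w)`. -/
def withHeight (x : Fin 3 → ℝ) (z : ℝ) : Fin 4 → ℝ := ![x 0, x 1, z, x 2]

/-- The projection of `(x, y, z, w)` to `(x, y, w)`. -/
def shadow (v : Fin 4 → ℝ) : Fin 3 → ℝ := ![v 0, v 1, v 3]

@[simp] theorem shadow_withHeight (x : Fin 3 → ℝ) (z : ℝ) : shadow (withHeight x z) = x := by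
  ext i; fin_cases i <;> rfl

@[simp] theorem withHeight_apply_two (x : Fin 3 → ℝ) (z : ℝ) : withHeight x z 2 = z := rfl

@[simp] theorem withHeight_shadow (v : Fin 4 → ℝ) : withHeight (shadow v) (v 2) = v := by
  ext i; fin_cases i <;> rfl

theorem shadow_smul (c : ℝ) (v : Fin 4 → ℝ) : shadow (c • v) = c • shadow v := by
  ext i; fin_cases i <;> rfl

theorem smul_withHeight (c : ℝ) (x : Fin 3 → ℝ) (z : ℝ) :
    c • withHeight x z = withHeight (c • x) (c * z) := by
  ext i; fin_cases i <;> rfl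

theorem withHeight_zero : withHeight 0 0 = 0 := by
  ext i; fin_cases i <;> rfl

theorem withHeight_ne_zero {x : Fin 3 → ℝ} (hx : x ≠ 0) (z : ℝ) : withHeight x z ≠ 0 := by
  intro h
  apply hx
  rw [← shadow_withHeight x z, h]
  ext i; fin_cases i <;> rfl

theorem continuous_shadow : Continuous shadow := by
  refine continuous_pi fun i => ?_
  fin_cases i
  exacts [continuous_apply (0 : Fin 4), continuous_apply (1 : Fin 4), continuous_apply (3 : Fin 4)]

theorem continuous_withHeight : Continuous fun p : (Fin 3 → ℝ) × ℝ => withHeight p.1 p.2 := by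
  refine continuous_pi fun i => ?_
  fin_cases i
  exacts [(continuous_apply (0 : Fin 3)).comp continuous_fst,
    (continuous_apply (1 : Fin 3)).comp continuous_fst, continuous_snd,
    (continuous_apply (2 : Fin 3)).comp continuous_fst]

theorem continuous_nrm : Continuous nrm := by
  unfold nrm
  fun_prop

theorem nrm_nonneg (x : Fin 3 → ℝ) : 0 ≤ nrm x := Real.sqrt_nonneg _

theorem nrm_sq (x : Fin 3 → ℝ) : nrm x ^ 2 = x 0 ^ 2 + x 1 ^ 2 + x 2 ^ 2 :=
  Real.sq_sqrt (by positivity)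

theorem nrm_zero : nrm 0 = 0 := by simp [nrm]

theorem abs_apply_le_nrm (x : Fin 3 → ℝ) (i : Fin 3) : |x i| ≤ nrm x := by
  refine Real.abs_le_sqrt ?_
  have h0 := sq_nonneg (x 0)
  have h1 := sq_nonneg (x 1)
  have h2 := sq_nonneg (x 2)
  match i with
  | 0 => linarith
  | 1 => linarith
  | 2 => linarith

theorem nrm_eq_zero {x : Fin 3 → ℝ} (h : nrm x = 0) : x = 0 :=
  funext fun i => abs_nonpos_iff.1 (h ▸ abs_apply_le_nrm x i)

theorem nrm_pos {x : Fin 3 → ℝ} (h : x ≠ 0) : 0 < nrm x :=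
  lt_of_le_of_ne (nrm_nonneg x) fun h' => h (nrm_eq_zero h'.symm)

theorem nrm_smul (c : ℝ) (x : Fin 3 → ℝ) : nrm (c • x) = |c| * nrm x := by
  rw [nrm, nrm, ← Real.sqrt_sq_eq_abs, ← Real.sqrt_mul (sq_nonneg c)]
  congr 1
  simp only [Pi.smul_apply, smul_eq_mul]
  ring

/-- The linear map `M`, rescaled on every ray so as to preserve the norm. -/
def stretch (M : Matrix (Fin 3) (Fin 3) ℝ) (x : Fin 3 → ℝ) : Fin 3 → ℝ :=
  (nrm x / nrm (M.mulVec x)) • M.mulVec x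

theorem mulVec_ne_zero {M : Matrix (Fin 3) (Fin 3) ℝ} (hM : M.det ≠ 0) {x : Fin 3 → ℝ}
    (hx : x ≠ 0) : M.mulVec x ≠ 0 :=
  fun h => hx (Matrix.eq_zero_of_mulVec_eq_zero hM h)

theorem nrm_stretch_le (M : Matrix (Fin 3) (Fin 3) ℝ) (x : Fin 3 → ℝ) :
    nrm (stretch M x) ≤ nrm x := by
  rw [stretch, nrm_smul, abs_of_nonneg (div_nonneg (nrm_nonneg _) (nrm_nonneg _))]
  by_cases h : nrm (M.mulVec x) = 0
  · rw [h, mul_zero]; exact nrm_nonneg x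
  · rw [div_mul_cancel₀ _ h]

theorem nrm_stretch {M : Matrix (Fin 3) (Fin 3) ℝ} (hM : M.det ≠ 0) (x : Fin 3 → ℝ) :
    nrm (stretch M x) = nrm x := by
  by_cases hx : x = 0
  · simp [hx, stretch, nrm_zero]
  rw [stretch, nrm_smul, abs_of_nonneg (div_nonneg (nrm_nonneg _) (nrm_nonneg _)),
    div_mul_cancel₀ _ (nrm_pos (mulVec_ne_zero hM hx)).ne']

theorem stretch_smul (M : Matrix (Fin 3) (Fin 3) ℝ) {c : ℝ} (hc : c ≠ 0) (x : Fin 3 → ℝ) :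
    stretch M (c • x) = c • stretch M x := by
  rw [stretch, stretch, Matrix.mulVec_smul, nrm_smul, nrm_smul, smul_smul, smul_smul,
    mul_div_mul_left _ _ (abs_ne_zero.2 hc), mul_comm]

theorem stretch_of_mulVec {M : Matrix (Fin 3) (Fin 3) ℝ} {x y : Fin 3 → ℝ} (h : M.mulVec x = y) :
    stretch M x = (nrm x / nrm y) • y := by
  rw [stretch, h]

/-- A stretch acts on rays as its matrix does and keeps the norm, so inverse matrices give inverse
stretches. -/
theorem stretch_stretch {M N : Matrix (Fin 3) (Fin 3) ℝ} (hNM : N * M = 1) (hM : M.det ≠ 0)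
    (x : Fin 3 → ℝ) : stretch N (stretch M x) = x := by
  by_cases hx : x = 0
  · simp [hx, stretch]
  have h1 : N.mulVec (stretch M x) = (nrm x / nrm (M.mulVec x)) • x := by
    rw [stretch, Matrix.mulVec_smul, Matrix.mulVec_mulVec, hNM, Matrix.one_mulVec]
  have h2 : 0 < nrm x := nrm_pos hx
  have h3 : 0 < nrm (M.mulVec x) := nrm_pos (mulVec_ne_zero hM hx)
  rw [stretch_of_mulVec h1, nrm_stretch hM, nrm_smul, abs_of_pos (div_pos h2 h3), smul_smul]
  convert one_smul ℝ x using 2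
  field_simp

/-- At the zero vector the stretch is squeezed by the norm of its argument. This is what makes the
twists continuous at the pole, where `(x, y, w) = 0` and the linear part may vary. -/
theorem continuousAt_stretch {X : Type*} [TopologicalSpace X] {M : X → Matrix (Fin 3) (Fin 3) ℝ}
    {x : X → Fin 3 → ℝ} {p : X} (hM : ContinuousAt M p) (hx : ContinuousAt x p)
    (hdet : (M p).det ≠ 0) : ContinuousAt (fun q => stretch (M q) (x q)) p := by
  by_cases h0 : x p = 0
  · have h1 : stretch (M p) (x p) = 0 := by simp [h0, stretch]
    rw [ContinuousAt, h1]
    have h2 : Filter.Tendsto (fun q => nrm (x q)) (nhds p) (nhds 0) := by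
      have := (continuous_nrm.continuousAt (x := x p)).comp hx
      rw [ContinuousAt, Function.comp_apply, h0, nrm_zero] at this
      exact this
    refine tendsto_pi_nhds.2 fun i => ?_
    refine squeeze_zero_norm (fun q => ?_) h2
    exact (abs_apply_le_nrm _ i).trans (nrm_stretch_le _ _)
  · have h1 : ContinuousAt (fun q => (M q).mulVec (x q)) p :=
      (Continuous.matrix_mulVec continuous_fst continuous_snd).continuousAt.comp (hM.prodMk hx)
    have h2 := (continuous_nrm.continuousAt (x := x p)).comp hx
    have h3 : ContinuousAt (fun q => nrm ((M q).mulVec (x q))) p :=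
      continuous_nrm.continuousAt.comp h1
    exact (h2.div h3 (nrm_pos (mulVec_ne_zero hdet h0)).ne').smul h1

/-- Let `B` be a path of invertible matrices and `U` a function of the ratio `|z| : |(x, y, w)|`.
There is an isotopy of `RP 3` which ends with the transformation that maps each vector
`(B(U) y, z)` to `(y, z)`, up to a change of signs of coordinates and a positive factor of `y`
that preserves the ratio. -/
theorem exists_twist (B : ℝ → Matrix (Fin 3) (Fin 3) ℝ)
    (hB : ∀ u ∈ Set.Icc (0 : ℝ) (1 / 2), ContinuousAt B u ∧ (B u).det ≠ 0)
    (U : (Fin 4 → ℝ) → ℝ) (hUc : ∀ v, v ≠ 0 → ContinuousAt U v)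
    (hUr : ∀ v, U v ∈ Set.Icc (0 : ℝ) (1 / 2))
    (hU : ∀ (v w : Fin 4 → ℝ) (c : ℝ), c ≠ 0 → nrm (shadow v) = |c| * nrm (shadow w) →
      |v 2| = |c| * |w 2| → U v = U w) :
    ∃ d : Fin 3 → ℝ, (∀ i, d i * d i = 1) ∧
    ∃ H : unitInterval → RP 3 ≃ₜ RP 3,
      Continuous (fun p : unitInterval × RP 3 => H p.1 p.2) ∧ H 0 = Homeomorph.refl _ ∧
      ∃ (φ : (Fin 4 → ℝ) → (Fin 4 → ℝ)) (hφ : ∀ v, v ≠ 0 → φ v ≠ 0),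
        (∀ v hv, H 1 (Projectivization.mk ℝ v hv) = Projectivization.mk ℝ (φ v) (hφ v hv)) ∧
        ∀ x y z, x = (B (U (withHeight x z))).mulVec y →
          φ (withHeight x z) = withHeight ((nrm x / nrm (d * y)) • (d * y)) z := by
  -- The path from `B 0` to a sign matrix makes the isotopy start at the identity: at time `0` the
  -- matrix below is `C 0 * (B 0)⁻¹ = 1`, and at time `1` it is the sign matrix times `(B (U v))⁻¹`.
  obtain ⟨C, hC, C0, hdet, d, hd, C1⟩ :=
    exists_path_to_signs (B 0) (hB 0 (by norm_num)).2
  have hmem : ∀ (s : unitInterval) v, (s : ℝ) * U v ∈ Set.Icc (0 : ℝ) (1 / 2) := by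
    intro s v
    have h1 := s.2.1
    have h2 := s.2.2
    have h3 := (hUr v).1
    have h4 := (hUr v).2
    exact ⟨mul_nonneg h1 h3, (mul_le_of_le_one_left h3 h2).trans h4⟩
  have hBd : ∀ (s : unitInterval) v, (B (s * U v)).det ≠ 0 := fun s v => (hB _ (hmem s v)).2
  have hCi : ∀ s, (C s)⁻¹ * C s = 1 := fun s => Matrix.nonsing_inv_mul _ (hdet s).isUnit
  have hCi' : ∀ s, C s * (C s)⁻¹ = 1 := fun s => Matrix.mul_nonsing_inv _ (hdet s).isUnit
  have hBi : ∀ (s : unitInterval) v, (B (s * U v))⁻¹ * B (s * U v) = 1 :=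
    fun s v => Matrix.nonsing_inv_mul _ (hBd s v).isUnit
  have hBi' : ∀ (s : unitInterval) v, B (s * U v) * (B (s * U v))⁻¹ = 1 :=
    fun s v => Matrix.mul_nonsing_inv _ (hBd s v).isUnit
  set M : unitInterval → (Fin 4 → ℝ) → Matrix (Fin 3) (Fin 3) ℝ :=
    fun s v => C s * (B (s * U v))⁻¹ with hMdef
  set N : unitInterval → (Fin 4 → ℝ) → Matrix (Fin 3) (Fin 3) ℝ :=
    fun s v => B (s * U v) * (C s)⁻¹ with hNdef
  have hNM : ∀ s v, N s v * M s v = 1 := by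
    intro s v
    simp only [hMdef, hNdef]
    rw [Matrix.mul_assoc, ← Matrix.mul_assoc (C s)⁻¹, hCi, Matrix.one_mul, hBi']
  have hMN : ∀ s v, M s v * N s v = 1 := by
    intro s v
    simp only [hMdef, hNdef]
    rw [Matrix.mul_assoc, ← Matrix.mul_assoc (B _)⁻¹, hBi, Matrix.one_mul, hCi']
  have hMd : ∀ s v, (M s v).det ≠ 0 := by
    intro s v h
    have := congrArg Matrix.det (hNM s v)
    rw [Matrix.det_mul, h, mul_zero, Matrix.det_one] at this
    exact zero_ne_one this
  have hNd : ∀ s v, (N s v).det ≠ 0 := by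
    intro s v h
    have := congrArg Matrix.det (hNM s v)
    rw [Matrix.det_mul, h, zero_mul, Matrix.det_one] at this
    exact zero_ne_one this
  -- A stretch keeps both `z` and the norm of `(x, y, w)`, hence each level of `U`. So the twist and
  -- its candidate inverse use the same matrices, and invertibility is checked one level at a time.
  have hUs : ∀ (L : Matrix (Fin 3) (Fin 3) ℝ), L.det ≠ 0 → ∀ v,
      U (withHeight (stretch L (shadow v)) (v 2)) = U v := by
    intro L hL v
    exact hU _ _ 1 one_ne_zero (by simp [nrm_stretch hL]) (by simp)
  have hUsm : ∀ (c : ℝ) v, c ≠ 0 → U (c • v) = U v := by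
    intro c v hc
    exact hU _ _ c hc (by rw [shadow_smul, nrm_smul]) (by simp [abs_mul])
  have hMU : ∀ s {v w}, U v = U w → M s v = M s w := by
    intro s v w h; simp only [hMdef, h]
  have hNU : ∀ s {v w}, U v = U w → N s v = N s w := by
    intro s v w h; simp only [hNdef, h]
  have inv1 : ∀ s v, withHeight (stretch (N s (withHeight (stretch (M s v) (shadow v)) (v 2)))
      (shadow (withHeight (stretch (M s v) (shadow v)) (v 2))))
      (withHeight (stretch (M s v) (shadow v)) (v 2) 2) = v := by
    intro s v
    rw [hNU s (hUs _ (hMd s v) v), shadow_withHeight, withHeight_apply_two,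
      stretch_stretch (hNM s v) (hMd s v), withHeight_shadow]
  have inv2 : ∀ s v, withHeight (stretch (M s (withHeight (stretch (N s v) (shadow v)) (v 2)))
      (shadow (withHeight (stretch (N s v) (shadow v)) (v 2))))
      (withHeight (stretch (N s v) (shadow v)) (v 2) 2) = v := by
    intro s v
    rw [hMU s (hUs _ (hNd s v) v), shadow_withHeight, withHeight_apply_two,
      stretch_stretch (hMN s v) (hNd s v), withHeight_shadow]
  have hne : ∀ (L : Matrix (Fin 3) (Fin 3) ℝ), L.det ≠ 0 → ∀ v, v ≠ 0 →
      withHeight (stretch L (shadow v)) (v 2) ≠ 0 := by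
    intro L hL v hv h
    apply hv
    have h2 : v 2 = 0 := by
      have := congrFun h 2
      simpa using this
    have h1 : shadow v = 0 := by
      refine nrm_eq_zero ?_
      rw [← nrm_stretch hL, ← shadow_withHeight (stretch L (shadow v)) (v 2), h]
      simp [shadow, nrm]
    rw [← withHeight_shadow v, h1, h2, withHeight_zero]
  have hsm : ∀ (L : Matrix (Fin 3) (Fin 3) ℝ) (c : ℝ) (v : Fin 4 → ℝ), c ≠ 0 →
      withHeight (stretch L (shadow (c • v))) ((c • v) 2)
        = c • withHeight (stretch L (shadow v)) (v 2) := by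
    intro L c v hc
    rw [shadow_smul, stretch_smul _ hc, smul_withHeight]
    rfl
  have hBc : ∀ s v, v ≠ 0 → ContinuousAt
      (fun p : unitInterval × (Fin 4 → ℝ) => B (p.1 * U p.2)) (s, v) := by
    intro s v hv
    have h1 : ContinuousAt (fun p : unitInterval × (Fin 4 → ℝ) => (p.1 : ℝ) * U p.2) (s, v) := by
      refine ContinuousAt.mul (by fun_prop) ?_
      exact (hUc v hv).comp (f := Prod.snd) (x := (s, v)) continuousAt_snd
    exact (hB _ (hmem s v)).1.comp (x := (s, v)) h1
  have hmulc : Continuous fun p : Matrix (Fin 3) (Fin 3) ℝ × Matrix (Fin 3) (Fin 3) ℝ =>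
      p.1 * p.2 := continuous_fst.matrix_mul continuous_snd
  have hfin : ∀ (L : unitInterval → (Fin 4 → ℝ) → Matrix (Fin 3) (Fin 3) ℝ) s v,
      ContinuousAt (fun p : unitInterval × (Fin 4 → ℝ) => L p.1 p.2) (s, v) → (L s v).det ≠ 0 →
      ContinuousAt (fun p : unitInterval × (Fin 4 → ℝ) =>
        withHeight (stretch (L p.1 p.2) (shadow p.2)) (p.2 2)) (s, v) := by
    intro L s v hL hLd
    refine continuous_withHeight.continuousAt.comp (ContinuousAt.prodMk
      (continuousAt_stretch hL (continuous_shadow.comp continuous_snd).continuousAt hLd) ?_)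
    exact ((continuous_apply (2 : Fin 4)).comp continuous_snd).continuousAt
  have hC' : ∀ s v, ContinuousAt (fun p : unitInterval × (Fin 4 → ℝ) => C p.1) (s, v) :=
    fun s v => (hC.comp continuous_fst).continuousAt
  obtain ⟨H, hH, H0, H1⟩ := exists_isotopy
    (fun s v => withHeight (stretch (M s v) (shadow v)) (v 2))
    (fun s v => withHeight (stretch (N s v) (shadow v)) (v 2))
    (fun s v => hne _ (hMd s v) v) (fun s v => hne _ (hNd s v) v)
    (fun s c v hc => by rw [hMU s (hUsm c v hc)]; exact hsm _ c v hc)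
    (fun s c v hc => by rw [hNU s (hUsm c v hc)]; exact hsm _ c v hc)
    (fun s v hv => hfin M s v (hmulc.continuousAt.comp
      ((hC' s v).prodMk (continuousAt_matrix_inv (hBc s v hv) (hBd s v)))) (hMd s v))
    (fun s v hv => hfin N s v (hmulc.continuousAt.comp
      ((hBc s v hv).prodMk (continuousAt_matrix_inv (hC' s v) (hdet s)))) (hNd s v))
    (fun s v _ => inv1 s v) (fun s v _ => inv2 s v)
    (fun v => by
      have h1 : M 0 v = 1 := by
        simp only [hMdef, C0, Set.Icc.coe_zero, zero_mul]
        exact Matrix.mul_nonsing_inv _ (hB 0 (by norm_num)).2.isUnit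
      have h2 : stretch 1 (shadow v) = shadow v := by
        by_cases h : shadow v = 0
        · simp [h, stretch]
        · rw [stretch_of_mulVec (Matrix.one_mulVec _), div_self (nrm_pos h).ne', one_smul]
      rw [h1, h2, withHeight_shadow])
  refine ⟨d, hd, H, hH, H0, _, fun v hv => hne _ (hMd 1 v) v hv, H1 1, ?_⟩
  intro x y z hxy
  have hy : (M 1 (withHeight x z)).mulVec x = d * y := by
    have h1 : (B (U (withHeight x z)))⁻¹.mulVec x = y := by
      have := hBi 1 (withHeight x z)
      rw [Set.Icc.coe_one, one_mul] at this
      rw [← Matrix.one_mulVec y, ← this, ← Matrix.mulVec_mulVec, ← hxy]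
    simp only [hMdef, Set.Icc.coe_one, one_mul]
    rw [← Matrix.mulVec_mulVec, h1, C1]
    ext i
    simp [Matrix.mulVec_diagonal]
  simp only [shadow_withHeight, withHeight_apply_two]
  rw [stretch_of_mulVec hy]

/-! ### Frames along pairs of symmetric points of a curve -/

/-- The quotient `f / g`, extended to the zeros of `g` by the quotient of the derivatives. -/
def lhopital (f : ℝ → Fin 3 → ℝ) (g : ℝ → ℝ) (u : ℝ) : Fin 3 → ℝ :=
  open Classical in
  if g u = 0 then (deriv g u)⁻¹ • deriv f u else (g u)⁻¹ • f u

theorem smul_lhopital {f : ℝ → Fin 3 → ℝ} {g : ℝ → ℝ} {u : ℝ} (h : g u = 0 → f u = 0) :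
    g u • lhopital f g u = f u := by
  unfold lhopital
  split_ifs with h0
  · rw [h0, h h0, zero_smul]
  · rw [smul_smul, mul_inv_cancel₀ h0, one_smul]

theorem continuousAt_lhopital {f : ℝ → Fin 3 → ℝ} {g : ℝ → ℝ} {u : ℝ} (hf : DifferentiableAt ℝ f u)
    (hg : DifferentiableAt ℝ g u) (h : g u = 0 → f u = 0 ∧ deriv g u ≠ 0) :
    ContinuousAt (lhopital f g) u := by
  by_cases h0 : g u = 0
  · obtain ⟨hfu, hgu⟩ := h h0
    have h1 : lhopital f g u = (deriv g u)⁻¹ • deriv f u := by simp [lhopital, h0]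
    rw [continuousAt_iff_punctured_nhds, h1]
    have hs := hasDerivAt_iff_tendsto_slope.1 hf.hasDerivAt
    have hs' := hasDerivAt_iff_tendsto_slope.1 hg.hasDerivAt
    refine ((hs'.inv₀ hgu).smul hs).congr' ?_
    -- A zero of `g` with nonzero derivative is isolated, so nearby values are true quotients, equal
    -- to quotients of slopes.
    have hne := hg.hasDerivAt.eventually_ne (c := 0) hgu
    filter_upwards [hne, self_mem_nhdsWithin] with x hx hxu
    have hxu' : x - u ≠ 0 := sub_ne_zero.2 hxu
    simp only [lhopital, hx, if_false, slope, vsub_eq_sub, h0, hfu, sub_zero, smul_eq_mul]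
    rw [smul_smul]
    congr 1
    field_simp
  · have h1 : ∀ᶠ x in nhds u, (g x)⁻¹ • f x = lhopital f g x := by
      filter_upwards [hg.continuousAt.eventually_ne h0] with x hx
      simp [lhopital, hx]
    exact ((hg.continuousAt.inv₀ h0).smul hf.continuousAt).congr h1

/-- The matrix with the columns `p`, `q` and `p × q`. -/
def frame (p q : Fin 3 → ℝ) : Matrix (Fin 3) (Fin 3) ℝ :=
  !![p 0, q 0, p 1 * q 2 - p 2 * q 1; p 1, q 1, p 2 * q 0 - p 0 * q 2;
    p 2, q 2, p 0 * q 1 - p 1 * q 0]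

theorem frame_mulVec (p q : Fin 3 → ℝ) (a b : ℝ) :
    (frame p q).mulVec ![a, b, 0] = a • p + b • q := by
  ext i
  fin_cases i <;> simp [frame, Matrix.mulVec, dotProduct, Fin.sum_univ_three] <;> ring

/-- The determinant is the squared norm of `p × q`, which vanishes only for dependent `p`, `q`.
Completing a pair by its cross product thus gives an invertible matrix depending continuously on the
pair. -/
theorem det_frame_ne_zero {p q : Fin 3 → ℝ} (h : LinearIndependent ℝ ![p, q]) :
    (frame p q).det ≠ 0 := by
  have h1 : (frame p q).det = (p 1 * q 2 - p 2 * q 1) ^ 2 + (p 2 * q 0 - p 0 * q 2) ^ 2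
      + (p 0 * q 1 - p 1 * q 0) ^ 2 := by
    rw [frame, Matrix.det_fin_three]
    simp
    ring
  rw [h1]
  intro h0
  have e0 : p 1 * q 2 - p 2 * q 1 = 0 := by
    nlinarith [sq_nonneg (p 1 * q 2 - p 2 * q 1), sq_nonneg (p 2 * q 0 - p 0 * q 2),
      sq_nonneg (p 0 * q 1 - p 1 * q 0)]
  have e1 : p 2 * q 0 - p 0 * q 2 = 0 := by
    nlinarith [sq_nonneg (p 1 * q 2 - p 2 * q 1), sq_nonneg (p 2 * q 0 - p 0 * q 2),
      sq_nonneg (p 0 * q 1 - p 1 * q 0)]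
  have e2 : p 0 * q 1 - p 1 * q 0 = 0 := by
    nlinarith [sq_nonneg (p 1 * q 2 - p 2 * q 1), sq_nonneg (p 2 * q 0 - p 0 * q 2),
      sq_nonneg (p 0 * q 1 - p 1 * q 0)]
  have hp := LinearIndependent.pair_iff.1 h
  have hq : q ≠ 0 := by
    rintro rfl
    exact one_ne_zero (hp 0 1 (by simp)).2
  apply hq
  ext i
  refine neg_eq_zero.1 ?_
  match i with
  | 0 => exact (hp (q 0) (-p 0) (by
      ext j; fin_cases j <;> simp <;> linarith)).1 |> fun h => by simp [h]
  | 1 => exact (hp (q 1) (-p 1) (by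
      ext j; fin_cases j <;> simp <;> linarith)).1 |> fun h => by simp [h]
  | 2 => exact (hp (q 2) (-p 2) (by
      ext j; fin_cases j <;> simp <;> linarith)).1 |> fun h => by simp [h]

theorem linearIndependent_pair_of_combination {E : Type*} [AddCommGroup E] [Module ℝ E]
    {p q p' q' : E} (h : LinearIndependent ℝ ![p, q]) (a b c d : ℝ)
    (hp : p' = a • p + b • q) (hq : q' = c • p + d • q) (hdet : a * d - b * c ≠ 0) : LinearIndependent ℝ ![p', q'] := by
  rw [LinearIndependent.pair_iff] at h ⊢
  intro s t hst
  obtain ⟨h1, h2⟩ := h (s * a + t * c) (s * b + t * d) (by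
    rw [← hst, hp, hq]; module)
  constructor
  · have : s * (a * d - b * c) = 0 := by linear_combination d * h1 - c * h2
    exact (mul_eq_zero.1 this).resolve_right hdet
  · have : t * (a * d - b * c) = 0 := by linear_combination a * h2 - b * h1
    exact (mul_eq_zero.1 this).resolve_right hdet

/-- If `(a, b)` and `(a, -b)` have the same coincidences as the points `F u` and `F (-u)`, then
there is a continuous frame in which `F u` and `F (-u)` have the coordinates `(a, b, 0)` and
`(a, -b, 0)`. -/
theorem exists_frame {F : ℝ → Fin 3 → ℝ} {a b : ℝ → ℝ} (hF : Differentiable ℝ F)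
    (ha : Differentiable ℝ a) (hb : Differentiable ℝ b)
    (hF' : ∀ u, LinearIndependent ℝ ![F u, deriv F u])
    (ha0 : ∀ u ∈ Set.Icc (0 : ℝ) (1 / 2), a u = 0 →
      deriv a u ≠ 0 ∧ F (-u) = -F u ∧ deriv F (-u) = -deriv F u)
    (hb0 : ∀ u ∈ Set.Icc (0 : ℝ) (1 / 2), b u = 0 →
      deriv b u ≠ 0 ∧ F (-u) = F u ∧ deriv F (-u) = deriv F u)
    (hab : ∀ u ∈ Set.Icc (0 : ℝ) (1 / 2), a u ≠ 0 → b u ≠ 0 →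
      LinearIndependent ℝ ![F u, F (-u)]) :
    ∃ B : ℝ → Matrix (Fin 3) (Fin 3) ℝ,
      (∀ u ∈ Set.Icc (0 : ℝ) (1 / 2), ContinuousAt B u ∧ (B u).det ≠ 0) ∧
      ∀ u ∈ Set.Icc (0 : ℝ) (1 / 2), (B u).mulVec ![a u, b u, 0] = F u ∧
        (B u).mulVec ![a u, -b u, 0] = F (-u) := by
  have hFm : Differentiable ℝ fun u => F (-u) := hF.comp differentiable_neg
  have hdm : ∀ u, deriv (fun u => F (-u)) u = -deriv F (-u) := fun u => deriv_comp_neg F u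
  -- Solving `F u = a p + b q`, `F (-u) = a p - b q` gives `p` and `q` as these quotients. Where `a`
  -- or `b` vanishes, the numerator vanishes too and the quotient extends by a multiple of `F' u`.
  set p := lhopital (fun u => F u + F (-u)) (fun u => 2 * a u) with hp
  set q := lhopital (fun u => F u - F (-u)) (fun u => 2 * b u) with hq
  have hap : ∀ u ∈ Set.Icc (0 : ℝ) (1 / 2), (2 * a u) • p u = F u + F (-u) := by
    intro u hu
    refine smul_lhopital (f := fun u => F u + F (-u)) (g := fun u => 2 * a u) fun h => ?_
    simp [(ha0 u hu (by simpa using h)).2.1]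
  have hbq : ∀ u ∈ Set.Icc (0 : ℝ) (1 / 2), (2 * b u) • q u = F u - F (-u) := by
    intro u hu
    refine smul_lhopital (f := fun u => F u - F (-u)) (g := fun u => 2 * b u) fun h => ?_
    simp [(hb0 u hu (by simpa using h)).2.1]
  refine ⟨fun u => frame (p u) (q u), fun u hu => ⟨?_, ?_⟩, fun u hu => ⟨?_, ?_⟩⟩
  · have hpc : ContinuousAt p u := by
      refine continuousAt_lhopital (hF.add hFm u) (ha.const_mul 2 u) fun h => ?_
      obtain ⟨h1, h2, -⟩ := ha0 u hu (by simpa using h)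
      refine ⟨by simp [h2], ?_⟩
      rw [deriv_const_mul _ (ha u)]
      exact mul_ne_zero two_ne_zero h1
    have hqc : ContinuousAt q u := by
      refine continuousAt_lhopital (hF.sub hFm u) (hb.const_mul 2 u) fun h => ?_
      obtain ⟨h1, h2, -⟩ := hb0 u hu (by simpa using h)
      refine ⟨by simp [h2], ?_⟩
      rw [deriv_const_mul _ (hb u)]
      exact mul_ne_zero two_ne_zero h1
    have hfr : Continuous fun x : (Fin 3 → ℝ) × (Fin 3 → ℝ) => frame x.1 x.2 := by
      refine continuous_matrix fun i j => ?_
      fin_cases i <;> fin_cases j <;> simp [frame] <;> fun_prop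
    exact hfr.continuousAt.comp (hpc.prodMk hqc)
  · refine det_frame_ne_zero ?_
    have hpd : a u = 0 → p u = (deriv a u)⁻¹ • deriv F u := by
      intro h
      obtain ⟨h1, h2, h3⟩ := ha0 u hu h
      have e : deriv (fun u => F u + F (-u)) u = (2 : ℝ) • deriv F u := by
        rw [deriv_fun_add (hF u) (hFm u), hdm, h3, neg_neg, two_smul]
      simp only [hp, lhopital, h, mul_zero, if_true, e, deriv_const_mul _ (ha u)]
      rw [smul_smul]
      congr 1
      field_simp
    have hqd : b u = 0 → q u = (deriv b u)⁻¹ • deriv F u := by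
      intro h
      obtain ⟨h1, h2, h3⟩ := hb0 u hu h
      have e : deriv (fun u => F u - F (-u)) u = (2 : ℝ) • deriv F u := by
        rw [deriv_fun_sub (hF u) (hFm u), hdm, h3, sub_neg_eq_add, two_smul]
      simp only [hq, lhopital, h, mul_zero, if_true, e, deriv_const_mul _ (hb u)]
      rw [smul_smul]
      congr 1
      field_simp
    have hpe : a u ≠ 0 → p u = (2 * a u)⁻¹ • (F u + F (-u)) := by
      intro h
      rw [← hap u hu, smul_smul, inv_mul_cancel₀ (by simpa using h), one_smul]
    have hqe : b u ≠ 0 → q u = (2 * b u)⁻¹ • (F u - F (-u)) := by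
      intro h
      rw [← hbq u hu, smul_smul, inv_mul_cancel₀ (by simpa using h), one_smul]
    -- If `a` and `b` both vanished, then `F u = -F u = 0`. If exactly one vanishes, `p` and `q` are
    -- multiples of `F' u` and `F u` in some order. Otherwise they are independent combinations of
    -- `F u` and `F (-u)`.
    by_cases h1 : a u = 0 <;> by_cases h2 : b u = 0
    · exfalso
      have e := (ha0 u hu h1).2.1
      rw [(hb0 u hu h2).2.1] at e
      have e' : F u = 0 := self_eq_neg.1 e
      exact (hF' u).ne_zero 0 (by simpa using e')
    · refine linearIndependent_pair_of_combination (hF' u) 0 (deriv a u)⁻¹ (b u)⁻¹ 0 ?_ ?_ ?_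
      · rw [hpd h1]; module
      · rw [hqe h2, (ha0 u hu h1).2.1, mul_inv]; module
      · have := (ha0 u hu h1).1
        simp [h2, this]
    · refine linearIndependent_pair_of_combination (hF' u) (a u)⁻¹ 0 0 (deriv b u)⁻¹ ?_ ?_ ?_
      · rw [hpe h1, (hb0 u hu h2).2.1, mul_inv]; module
      · rw [hqd h2]; module
      · have := (hb0 u hu h2).1
        simp [h1, this]
    · refine linearIndependent_pair_of_combination (hab u hu h1 h2) (2 * a u)⁻¹ (2 * a u)⁻¹
        (2 * b u)⁻¹ (-(2 * b u)⁻¹) ?_ ?_ ?_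
      · rw [hpe h1]; module
      · rw [hqe h2]; module
      · have e : (2 * a u)⁻¹ * -(2 * b u)⁻¹ - (2 * a u)⁻¹ * (2 * b u)⁻¹ =
            -(2 * ((2 * a u)⁻¹ * (2 * b u)⁻¹)) := by ring
        rw [e]
        simp [h1, h2]
  · have e1 := hap u hu
    have e2 := hbq u hu
    rw [frame_mulVec]
    calc a u • p u + b u • q u = (1 / 2 : ℝ) • ((2 * a u) • p u + (2 * b u) • q u) := by module
      _ = F u := by rw [e1, e2]; module
  · have e1 := hap u hu
    have e2 := hbq u hu
    rw [frame_mulVec]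
    calc a u • p u + -b u • q u = (1 / 2 : ℝ) • ((2 * a u) • p u - (2 * b u) • q u) := by module
      _ = F (-u) := by rw [e1, e2]; module

/-! ### Flattening a knot level by level -/

theorem nrm_sign_mul {d : Fin 3 → ℝ} (hd : ∀ i, d i * d i = 1) (y : Fin 3 → ℝ) :
    nrm (d * y) = nrm y := by
  unfold nrm
  congr 1
  simp only [Pi.mul_apply]
  linear_combination y 0 ^ 2 * hd 0 + y 1 ^ 2 * hd 1 + y 2 ^ 2 * hd 2

/-- A closed curve over a curve of unit vectors `F`, with heights determined by a plane curve
`(a, b)` in such a way that the points over `F u` and `F (-u)` have the same height, can be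
untwisted to a plane curve. -/
theorem exists_ambientIsotopic_planar {F : ℝ → Fin 3 → ℝ} {a b z : ℝ → ℝ} (hn : ∀ u, nrm (F u) = 1)
    (hae : ∀ u, a (-u) = a u) (hbo : ∀ u, b (-u) = -b u) (hze : ∀ u, z (-u) = z u)
    (hne : ∀ u, 0 < nrm ![a u, b u, 0])
    (B : ℝ → Matrix (Fin 3) (Fin 3) ℝ)
    (hB : ∀ u ∈ Set.Icc (0 : ℝ) (1 / 2), ContinuousAt B u ∧ (B u).det ≠ 0)
    (hBF : ∀ u ∈ Set.Icc (0 : ℝ) (1 / 2), (B u).mulVec ![a u, b u, 0] = F u ∧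
        (B u).mulVec ![a u, -b u, 0] = F (-u))
    (U : (Fin 4 → ℝ) → ℝ) (hUc : ∀ v, v ≠ 0 → ContinuousAt U v)
    (hUr : ∀ v, U v ∈ Set.Icc (0 : ℝ) (1 / 2))
    (hU : ∀ (v w : Fin 4 → ℝ) (c : ℝ), c ≠ 0 → nrm (shadow v) = |c| * nrm (shadow w) →
      |v 2| = |c| * |w 2| → U v = U w)
    (hUu : ∀ u ∈ Set.Icc (0 : ℝ) (1 / 2), ∀ x, nrm x = 1 →
      U (withHeight x (z u / nrm ![a u, b u, 0])) = u) :
    ∃ d : Fin 3 → ℝ, (∀ i, d i * d i = 1) ∧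
      AmbientIsotopic
        (pointsOf {v | ∃ u ∈ Set.Icc (-(1 / 2) : ℝ) (1 / 2),
          v = withHeight (F u) (z u / nrm ![a u, b u, 0])})
        (pointsOf {v | ∃ u ∈ Set.Icc (-(1 / 2) : ℝ) (1 / 2),
          v = withHeight (d * ![a u, b u, 0]) (z u)}) := by
  obtain ⟨d, hd, H, hH, H0, φ, hφ, H1, hφx⟩ := exists_twist B hB U hUc hUr hU
  refine ⟨d, hd, ?_⟩
  have key : ∀ u ∈ Set.Icc (-(1 / 2) : ℝ) (1 / 2),
      nrm ![a u, b u, 0] • φ (withHeight (F u) (z u / nrm ![a u, b u, 0])) =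
        withHeight (d * ![a u, b u, 0]) (z u) := by
    intro u hu
    have hy : F u = (B (U (withHeight (F u) (z u / nrm ![a u, b u, 0])))).mulVec
        ![a u, b u, 0] := by
      -- The frame is only defined on `[0, 1/2]`. A negative `u` lies on the level of `-u`, where
      -- the second identity of `hBF` applies.
      rcases le_total 0 u with h | h
      · have hu' : u ∈ Set.Icc (0 : ℝ) (1 / 2) := ⟨h, hu.2⟩
        rw [hUu u hu' _ (hn u), (hBF u hu').1]
      · have hu' : -u ∈ Set.Icc (0 : ℝ) (1 / 2) := ⟨by linarith, by linarith [hu.1]⟩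
        have e : nrm ![a u, b u, 0] = nrm ![a (-u), b (-u), 0] := by
          rw [hae, hbo]; simp [nrm]
        have h2 := (hBF _ hu').2
        rw [neg_neg, hae, hbo, neg_neg] at h2
        rw [e, ← hze u, hUu _ hu' _ (hn u), h2]
    have hp := hne u
    rw [hφx _ _ _ hy, nrm_sign_mul hd, hn, smul_withHeight, smul_smul, mul_one_div_cancel hp.ne',
      one_smul, mul_div_cancel₀ _ hp.ne']
  refine ambientIsotopic_pointsOf hH H0 hφ H1 ?_ ?_
  · rintro _ ⟨u, hu, rfl⟩ -
    exact ⟨_, (hne u).ne', u, hu, key u hu⟩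
  · rintro _ ⟨u, hu, rfl⟩ -
    refine ⟨_, ⟨u, hu, rfl⟩, withHeight_ne_zero ?_ _, (nrm ![a u, b u, 0])⁻¹, ?_⟩
    · intro h
      have := hn u
      rw [h, nrm_zero] at this
      exact zero_ne_one this
    · rw [← key u hu, smul_smul, inv_mul_cancel₀ (hne u).ne', one_smul]

/-! ### The two unknots -/

theorem pointsOf_subset {n : ℕ} {P P' : Set (Fin (n + 1) → ℝ)}
    (h : ∀ v ∈ P, v ≠ 0 → ∃ c : ℝ, c ≠ 0 ∧ c • v ∈ P') : pointsOf P ⊆ pointsOf P' := by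
  rintro _ ⟨v, hv, hP, rfl⟩
  obtain ⟨c, hc, hcP⟩ := h v hP hv
  exact ⟨_, smul_ne_zero hc hv, hcP,
    ((Projectivization.mk_eq_mk_iff' ℝ _ _ _ _).2 ⟨c, rfl⟩).symm⟩

theorem planarCircle_eq :
    planarCircle = pointsOf {v : Fin 4 → ℝ | v 0 ^ 2 + v 1 ^ 2 = v 3 ^ 2 ∧ v 2 = 0} := by
  refine Set.Subset.antisymm (fun Q hQ => ⟨Q.rep, Q.rep_nonzero, hQ, Q.mk_rep.symm⟩) ?_
  rintro _ ⟨v, hv, ⟨h1, h2⟩, rfl⟩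
  obtain ⟨c, hc⟩ := Projectivization.exists_smul_eq_mk_rep ℝ v hv
  simp only [planarCircle, Set.mem_ofPred_eq, ← hc, Units.smul_def, Pi.smul_apply, smul_eq_mul, h2,
    mul_zero, and_true]
  linear_combination (c : ℝ) ^ 2 * h1

theorem projectiveLine_eq :
    projectiveLine = pointsOf {v : Fin 4 → ℝ | v 1 = 0 ∧ v 2 = 0} := by
  refine Set.Subset.antisymm (fun Q hQ => ⟨Q.rep, Q.rep_nonzero, hQ, Q.mk_rep.symm⟩) ?_
  rintro _ ⟨v, hv, ⟨h1, h2⟩, rfl⟩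
  obtain ⟨c, hc⟩ := Projectivization.exists_smul_eq_mk_rep ℝ v hv
  simp [projectiveLine, ← hc, h1, h2]

theorem sign_ne_zero {d : ℝ} (h : d * d = 1) : d ≠ 0 := by
  rintro rfl; simp at h

theorem ambientIsotopic_signed_circle {d : Fin 3 → ℝ} (hd : ∀ i, d i * d i = 1) :
    AmbientIsotopic
      (pointsOf {v | ∃ u ∈ Set.Icc (-(1 / 2) : ℝ) (1 / 2), v =
        withHeight (d * ![2 - Real.cos (2 * Real.pi * u), Real.sin (2 * Real.pi * u), 0]) 1})
      planarCircle := by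
  rw [planarCircle_eq]
  have hd0 := sign_ne_zero (hd 0)
  have hd1 := sign_ne_zero (hd 1)
  -- `N` carries the point `(cos, sin, 0, 1)` of the standard circle to `(d 0 * (2 - cos), d 1 *
  -- sin, 1, 0)`, a point of the signed model circle.
  set N : Matrix (Fin 4) (Fin 4) ℝ :=
    !![-d 0, 0, 0, 2 * d 0; 0, d 1, 0, 0; 0, 0, 0, 1; 0, 0, 1, 0] with hN
  have hdet : N.det ≠ 0 := by
    have : N.det = d 0 * d 1 := by
      rw [hN, Matrix.det_succ_row_zero]
      simp [Fin.sum_univ_four, Matrix.det_fin_three, Fin.succAbove]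
    rw [this]
    exact mul_ne_zero hd0 hd1
  have key : ∀ v : Fin 4 → ℝ, N.mulVec v =
      ![d 0 * (2 * v 3 - v 0), d 1 * v 1, v 3, v 2] := by
    intro v
    ext i
    fin_cases i <;> simp [hN, Matrix.mulVec, dotProduct, Fin.sum_univ_four]
    ring
  have hlin := ambientIsotopic_image_mulVec N hdet
    {v : Fin 4 → ℝ | v 0 ^ 2 + v 1 ^ 2 = v 3 ^ 2 ∧ v 2 = 0} (by
      rintro e he v ⟨h1, h2⟩
      refine ⟨?_, by simp [h2]⟩
      simp only [Pi.mul_apply]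
      linear_combination h1 + v 0 ^ 2 * he 0 + v 1 ^ 2 * he 1 - v 3 ^ 2 * he 3)
  convert hlin using 1
  refine Set.Subset.antisymm (pointsOf_subset ?_) (pointsOf_subset ?_)
  · rintro _ ⟨u, hu, rfl⟩ -
    refine ⟨1, one_ne_zero,
      ![Real.cos (2 * Real.pi * u), Real.sin (2 * Real.pi * u), 0, 1], ⟨?_, rfl⟩, ?_⟩
    · simp [Real.cos_sq_add_sin_sq]
    · rw [key]
      ext i
      fin_cases i <;> simp [withHeight]
  · rintro _ ⟨v, ⟨h1, h2⟩, rfl⟩ hv0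
    have h3 : v 3 ≠ 0 := by
      intro h3
      have e0 : v 0 = 0 := by
        rw [h3] at h1
        refine pow_eq_zero_iff two_ne_zero |>.1 ?_
        nlinarith [sq_nonneg (v 0), sq_nonneg (v 1)]
      have e1 : v 1 = 0 := by
        rw [h3] at h1
        refine pow_eq_zero_iff two_ne_zero |>.1 ?_
        nlinarith [sq_nonneg (v 0), sq_nonneg (v 1)]
      apply hv0
      rw [key, e0, e1, h2, h3]
      ext i
      fin_cases i <;> simp
    -- The parameter of a point of the circle is its argument divided by `2π`, which lies in `[-1/2,
    -- 1/2]`.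
    set ζ : ℂ := ⟨v 0 / v 3, v 1 / v 3⟩ with hζ
    have hζ1 : ‖ζ‖ = 1 := by
      rw [Complex.norm_def, Complex.normSq_mk]
      rw [Real.sqrt_eq_one]
      field_simp
      linarith
    have hc := Complex.norm_mul_cos_arg ζ
    have hs := Complex.norm_mul_sin_arg ζ
    rw [hζ1, one_mul] at hc hs
    have hpi := Real.pi_pos
    have e : 2 * Real.pi * (ζ.arg / (2 * Real.pi)) = ζ.arg := by field_simp
    refine ⟨(v 3)⁻¹, inv_ne_zero h3, ζ.arg / (2 * Real.pi), ⟨?_, ?_⟩, ?_⟩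
    · rw [le_div_iff₀ (by positivity)]
      linarith [Complex.neg_pi_lt_arg ζ]
    · rw [div_le_iff₀ (by positivity)]
      linarith [Complex.arg_le_pi ζ]
    · rw [e, hc, hs, key, h2]
      ext i
      fin_cases i <;> simp [withHeight, hζ] <;> field_simp

theorem ambientIsotopic_signed_line {d : Fin 3 → ℝ} (hd : ∀ i, d i * d i = 1) :
    AmbientIsotopic
      (pointsOf {v | ∃ u ∈ Set.Icc (-(1 / 2) : ℝ) (1 / 2), v =
        withHeight (d * ![Real.cos (Real.pi * u), Real.sin (Real.pi * u), 0])
          (Real.cos (Real.pi * u))})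
      projectiveLine := by
  rw [projectiveLine_eq]
  have hd0 := sign_ne_zero (hd 0)
  have hd1 := sign_ne_zero (hd 1)
  -- `N` carries `(cos, 0, 0, sin)` to `(d 0 * cos, d 1 * sin, cos, 0)`. The columns of the other
  -- two coordinates only serve to make it invertible.
  set N : Matrix (Fin 4) (Fin 4) ℝ :=
    !![d 0, 0, 1, 0; 0, 0, 0, d 1; 1, 0, 0, 0; 0, 1, 0, 0] with hN
  have hdet : N.det ≠ 0 := by
    have : N.det = d 1 := by
      rw [hN, Matrix.det_succ_row_zero]
      simp [Fin.sum_univ_four, Matrix.det_fin_three, Fin.succAbove]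
    rw [this]
    exact hd1
  have key : ∀ v : Fin 4 → ℝ, N.mulVec v = ![d 0 * v 0 + v 2, d 1 * v 3, v 0, v 1] := by
    intro v
    ext i
    fin_cases i <;> simp [hN, Matrix.mulVec, dotProduct, Fin.sum_univ_four]
  have hlin := ambientIsotopic_image_mulVec N hdet
    {v : Fin 4 → ℝ | v 1 = 0 ∧ v 2 = 0} (by
      rintro e he v ⟨h1, h2⟩
      exact ⟨by simp [h1], by simp [h2]⟩)
  convert hlin using 1
  refine Set.Subset.antisymm (pointsOf_subset ?_) (pointsOf_subset ?_)
  · rintro _ ⟨u, hu, rfl⟩ -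
    refine ⟨1, one_ne_zero,
      ![Real.cos (Real.pi * u), 0, 0, Real.sin (Real.pi * u)], ⟨rfl, rfl⟩, ?_⟩
    rw [key]
    ext i
    fin_cases i <;> simp [withHeight]
  · rintro _ ⟨v, ⟨h1, h2⟩, rfl⟩ hv0
    have hpi := Real.pi_pos
    by_cases h0 : v 0 = 0
    · have h3 : v 3 ≠ 0 := by
        intro h3
        apply hv0
        rw [key, h0, h1, h2, h3]
        ext i
        fin_cases i <;> simp
      refine ⟨(v 3)⁻¹, inv_ne_zero h3, 1 / 2, ⟨by norm_num, le_rfl⟩, ?_⟩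
      have e : Real.pi * (1 / 2) = Real.pi / 2 := by ring
      rw [e, Real.cos_pi_div_two, Real.sin_pi_div_two, key, h0, h1, h2]
      ext i
      fin_cases i <;> simp [withHeight]
      field_simp
    · set α := Real.arctan (v 3 / v 0) with hα
      have hc := Real.cos_arctan_pos (v 3 / v 0)
      have ht : Real.sin α = v 3 / v 0 * Real.cos α := by
        have := Real.tan_arctan (v 3 / v 0)
        rw [Real.tan_eq_sin_div_cos, div_eq_iff hc.ne'] at this
        exact this
      have e : Real.pi * (α / Real.pi) = α := by field_simp
      refine ⟨Real.cos α / v 0, div_ne_zero hc.ne' h0, α / Real.pi, ⟨?_, ?_⟩, ?_⟩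
      · rw [le_div_iff₀ hpi]
        linarith [Real.neg_pi_div_two_lt_arctan (v 3 / v 0)]
      · rw [div_le_iff₀ hpi]
        linarith [Real.arctan_lt_pi_div_two (v 3 / v 0)]
      · rw [e, ht, key, h1, h2]
        ext i
        fin_cases i <;> simp [withHeight] <;> field_simp

/-! ### The height profiles of the two unknots -/

theorem shadow_eq_zero_and {v : Fin 4 → ℝ} (h : nrm (shadow v) = 0) (h' : v 2 = 0) : v = 0 := by
  rw [← withHeight_shadow v, nrm_eq_zero h, h', withHeight_zero]

/-- The closed curve over a curve `F` of unit vectors, for which `F (u + 1) = F u`, with the heights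
of a circle in a plane through the pole. -/
theorem ambientIsotopic_planarCircle {F : ℝ → Fin 3 → ℝ} (hF : Differentiable ℝ F)
    (hn : ∀ u, nrm (F u) = 1) (hper : ∀ u, F (u + 1) = F u)
    (hF' : ∀ u, LinearIndependent ℝ ![F u, deriv F u])
    (hpair : ∀ u ∈ Set.Ioo (0 : ℝ) (1 / 2), LinearIndependent ℝ ![F u, F (-u)]) :
    AmbientIsotopic
      (pointsOf {v | ∃ u ∈ Set.Icc (-(1 / 2) : ℝ) (1 / 2),
        v = withHeight (F u) (1 / √(5 - 4 * Real.cos (2 * Real.pi * u)))}) planarCircle := by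
  have hpi := Real.pi_pos
  -- The model is the circle of radius `1` about `(2, 0)` in the plane `w = 0` with `z = 1`; the
  -- pole is the origin of this chart. The shift by `2` keeps `a` positive, as required by `F (u +
  -- 1) = F u`: only zeros of `b` may occur, at the ends `0` and `1/2`.
  set a : ℝ → ℝ := fun u => 2 - Real.cos (2 * Real.pi * u) with ha
  set b : ℝ → ℝ := fun u => Real.sin (2 * Real.pi * u) with hb
  have hda : Differentiable ℝ a := by simp only [ha]; fun_prop
  have hdb : Differentiable ℝ b := by simp only [hb]; fun_prop
  have ha0 : ∀ u, a u ≠ 0 := by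
    intro u
    have := Real.cos_le_one (2 * Real.pi * u)
    simp only [ha]; linarith
  have hnr : ∀ u, nrm ![a u, b u, 0] = √(5 - 4 * Real.cos (2 * Real.pi * u)) := by
    intro u
    simp only [nrm, ha, hb]
    congr 1
    simp
    linear_combination Real.sin_sq_add_cos_sq (2 * Real.pi * u)
  have hpos : ∀ u, 0 < 5 - 4 * Real.cos (2 * Real.pi * u) := by
    intro u
    linarith [Real.cos_le_one (2 * Real.pi * u)]
  have hbd : ∀ u, deriv b u = Real.cos (2 * Real.pi * u) * (2 * Real.pi) := by
    intro u
    have h1 : HasDerivAt (fun u : ℝ => 2 * Real.pi * u) (2 * Real.pi) u := by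
      simpa using (hasDerivAt_id u).const_mul (2 * Real.pi)
    exact h1.sin.deriv
  have hb0 : ∀ u ∈ Set.Icc (0 : ℝ) (1 / 2), b u = 0 →
      deriv b u ≠ 0 ∧ F (-u) = F u ∧ deriv F (-u) = deriv F u := by
    intro u hu hbu
    refine ⟨?_, ?_⟩
    · rw [hbd]
      refine mul_ne_zero (fun h => ?_) (by positivity)
      have := Real.sin_sq_add_cos_sq (2 * Real.pi * u)
      simp only [hb] at hbu
      rw [h, hbu] at this
      norm_num at this
    · have hcase : u = 0 ∨ u = 1 / 2 := by
        by_contra! hcon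
        have h1 : 0 < u := lt_of_le_of_ne hu.1 hcon.1.symm
        have h2 : u < 1 / 2 := lt_of_le_of_ne hu.2 hcon.2
        exact (Real.sin_pos_of_pos_of_lt_pi (x := 2 * Real.pi * u) (by positivity)
          (by nlinarith)).ne' hbu
      rcases hcase with rfl | rfl
      · simp
      · have e : (1 / 2 : ℝ) = -(1 / 2) + 1 := by norm_num
        refine ⟨?_, ?_⟩
        · conv_rhs => rw [e]
          exact (hper _).symm
        · conv_rhs => rw [e, ← deriv_comp_add_const]
          simp only [hper]
  obtain ⟨B, hB, hBF⟩ := exists_frame hF hda hdb hF' (fun u _ h => absurd h (ha0 u)) hb0 (by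
    intro u hu _ hbu
    refine hpair u ⟨lt_of_le_of_ne hu.1 ?_, lt_of_le_of_ne hu.2 ?_⟩
    · rintro rfl; simp [hb] at hbu
    · rintro rfl
      apply hbu
      have e : 2 * Real.pi * (1 / 2) = Real.pi := by ring
      simp only [hb, e, Real.sin_pi])
  obtain ⟨d, hd, hiso⟩ := exists_ambientIsotopic_planar (F := F) (a := a) (b := b) (z := fun _ => 1)
    hn (by simp [ha]) (by simp [hb]) (by simp)
    (fun u => by rw [hnr]; exact Real.sqrt_pos.2 (hpos u)) B hB hBF
    -- This solves `z² / |(x, y, w)|² = 1 / (5 - 4 cos 2πu)` for `u`. On the curve `z² ≥ |(x, y,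
    -- w)|² / 9`, as `5 - 4 cos ≤ 9`, so the maximum changes nothing there, and elsewhere it keeps
    -- the denominator nonzero. `Real.arccos` clamps its argument, so the values stay in `[0, 1/2]`.
    (fun v => Real.arccos ((5 * v 2 ^ 2 - nrm (shadow v) ^ 2) /
      (4 * max (v 2 ^ 2) (nrm (shadow v) ^ 2 / 9))) / (2 * Real.pi))
    (by
      intro v hv
      have hcn : Continuous fun v : Fin 4 → ℝ => nrm (shadow v) :=
        continuous_nrm.comp continuous_shadow
      have hm : 4 * max (v 2 ^ 2) (nrm (shadow v) ^ 2 / 9) ≠ 0 := by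
        refine mul_ne_zero (by norm_num) (ne_of_gt ?_)
        by_cases h2 : v 2 = 0
        · refine lt_max_of_lt_right ?_
          have : nrm (shadow v) ≠ 0 := fun h => hv (shadow_eq_zero_and h h2)
          positivity
        · refine lt_max_of_lt_left ?_
          positivity
      refine ContinuousAt.div_const ?_ _
      refine Real.continuous_arccos.continuousAt.comp (ContinuousAt.div ?_ ?_ hm)
      · exact Continuous.continuousAt (by fun_prop)
      · exact Continuous.continuousAt (by fun_prop))
    (by
      intro v
      refine ⟨div_nonneg (Real.arccos_nonneg _) (by positivity), ?_⟩
      rw [div_le_iff₀ (by positivity)]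
      linarith [Real.arccos_le_pi ((5 * v 2 ^ 2 - nrm (shadow v) ^ 2) /
        (4 * max (v 2 ^ 2) (nrm (shadow v) ^ 2 / 9)))])
    (by
      intro v w c hc h1 h2
      have h3 : v 2 ^ 2 = c ^ 2 * w 2 ^ 2 := by
        rw [← sq_abs (v 2), h2, mul_pow, sq_abs, sq_abs]
      have h4 : nrm (shadow v) ^ 2 = c ^ 2 * nrm (shadow w) ^ 2 := by
        rw [h1, mul_pow, sq_abs]
      have hc2 : c ^ 2 ≠ 0 := pow_ne_zero 2 hc
      simp only [h3, h4]
      rw [mul_div_assoc (c ^ 2), ← mul_max_of_nonneg _ _ (sq_nonneg c), mul_left_comm 5,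
        ← mul_sub, mul_left_comm 4, mul_div_mul_left _ _ hc2])
    (by
      intro u hu x hx
      simp only [shadow_withHeight, withHeight_apply_two, hx, hnr]
      rw [div_pow, Real.sq_sqrt (hpos u).le]
      set t := Real.cos (2 * Real.pi * u) with ht
      have h5 := hpos u
      rw [← ht] at h5
      have hm : max (1 ^ 2 / (5 - 4 * t)) (1 ^ 2 / 9) = 1 / (5 - 4 * t) := by
        rw [one_pow]
        refine max_eq_left ?_
        refine one_div_le_one_div_of_le h5 ?_
        linarith [Real.neg_one_le_cos (2 * Real.pi * u)]
      have e : (5 * (1 ^ 2 / (5 - 4 * t)) - 1 ^ 2) / (4 * (1 / (5 - 4 * t))) = t := by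
        field_simp
        ring
      rw [hm, e, ht, Real.arccos_cos (by have := hu.1; positivity) (by nlinarith [hu.2])]
      field_simp)
  simp only [hnr] at hiso
  exact hiso.trans (ambientIsotopic_signed_circle hd)

/-- The closed curve over a curve `F` of unit vectors, for which `F (u + 1) = -F u`, with the
heights of a line in a plane through the pole. -/
theorem ambientIsotopic_projectiveLine {F : ℝ → Fin 3 → ℝ} (hF : Differentiable ℝ F)
    (hn : ∀ u, nrm (F u) = 1) (hper : ∀ u, F (u + 1) = -F u)
    (hF' : ∀ u, LinearIndependent ℝ ![F u, deriv F u])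
    (hpair : ∀ u ∈ Set.Ioo (0 : ℝ) (1 / 2), LinearIndependent ℝ ![F u, F (-u)]) :
    AmbientIsotopic
      (pointsOf {v | ∃ u ∈ Set.Icc (-(1 / 2) : ℝ) (1 / 2),
        v = withHeight (F u) (Real.cos (Real.pi * u))}) projectiveLine := by
  have hpi := Real.pi_pos
  -- The model is the line `x = z`, `w = 0`. Here `a` vanishes at `u = 1/2`, where the two points of
  -- the level are opposite vectors, and `b` at `u = 0`, where they are equal.
  set a : ℝ → ℝ := fun u => Real.cos (Real.pi * u) with ha
  set b : ℝ → ℝ := fun u => Real.sin (Real.pi * u) with hb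
  have hda : Differentiable ℝ a := by simp only [ha]; fun_prop
  have hdb : Differentiable ℝ b := by simp only [hb]; fun_prop
  have hsc : ∀ u, b u ^ 2 + a u ^ 2 = 1 := fun u => Real.sin_sq_add_cos_sq _
  have hnr : ∀ u, nrm ![a u, b u, 0] = 1 := by
    intro u
    rw [nrm, Real.sqrt_eq_one]
    simp
    linarith [hsc u]
  have hlin : ∀ u, HasDerivAt (fun u : ℝ => Real.pi * u) Real.pi u := by
    intro u
    simpa using (hasDerivAt_id u).const_mul Real.pi
  have had : ∀ u, deriv a u = -b u * Real.pi := fun u => (hlin u).cos.deriv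
  have hbd : ∀ u, deriv b u = a u * Real.pi := fun u => (hlin u).sin.deriv
  have ha1 : ∀ u ∈ Set.Icc (0 : ℝ) (1 / 2), a u = 0 → u = 1 / 2 := by
    intro u hu h
    by_contra hcon
    have h2 : u < 1 / 2 := lt_of_le_of_ne hu.2 hcon
    exact (Real.cos_pos_of_mem_Ioo (x := Real.pi * u) ⟨by nlinarith [hu.1], by nlinarith⟩).ne' h
  have hb1 : ∀ u ∈ Set.Icc (0 : ℝ) (1 / 2), b u = 0 → u = 0 := by
    intro u hu h
    by_contra hcon
    have h1 : 0 < u := lt_of_le_of_ne hu.1 (Ne.symm hcon)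
    exact (Real.sin_pos_of_pos_of_lt_pi (x := Real.pi * u) (by positivity)
      (by nlinarith [hu.2])).ne' h
  obtain ⟨B, hB, hBF⟩ := exists_frame hF hda hdb hF'
    (by
      intro u hu hau
      refine ⟨?_, ?_⟩
      · rw [had]
        refine mul_ne_zero (neg_ne_zero.2 fun h => ?_) hpi.ne'
        have := hsc u
        rw [h, hau] at this
        norm_num at this
      · obtain rfl := ha1 u hu hau
        have e : (1 / 2 : ℝ) = -(1 / 2) + 1 := by norm_num
        refine ⟨?_, ?_⟩
        · conv_rhs => rw [e, hper, neg_neg]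
        · conv_rhs => rw [e, ← deriv_comp_add_const]
          simp only [hper]
          rw [deriv.fun_neg, neg_neg])
    (by
      intro u hu hbu
      refine ⟨?_, ?_⟩
      · rw [hbd]
        refine mul_ne_zero (fun h => ?_) hpi.ne'
        have := hsc u
        rw [h, hbu] at this
        norm_num at this
      · obtain rfl := hb1 u hu hbu
        simp)
    (by
      intro u hu hau hbu
      refine hpair u ⟨lt_of_le_of_ne hu.1 ?_, lt_of_le_of_ne hu.2 ?_⟩
      · rintro rfl; simp [hb] at hbu
      · rintro rfl
        apply hau
        have e : Real.pi * (1 / 2) = Real.pi / 2 := by ring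
        simp only [ha]
        rw [e, Real.cos_pi_div_two])
  obtain ⟨d, hd, hiso⟩ := exists_ambientIsotopic_planar (F := F) (a := a) (b := b) (z := a)
    hn (by simp [ha]) (by simp [hb]) (by simp [ha])
    (fun u => by rw [hnr]; exact one_pos) B hB hBF
    -- On the curve the norm of `(x, y, w)` is `1 ≥ |z|`, so the quotient is `cos πu`. Its
    -- nonnegativity bounds the arccosine by `π / 2`, hence `U` by `1/2`.
    (fun v => Real.arccos (|v 2| / max (nrm (shadow v)) |v 2|) / Real.pi)
    (by
      intro v hv
      have hcn : Continuous fun v : Fin 4 → ℝ => nrm (shadow v) :=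
        continuous_nrm.comp continuous_shadow
      have hm : max (nrm (shadow v)) |v 2| ≠ 0 := by
        refine ne_of_gt ?_
        by_cases h2 : v 2 = 0
        · refine lt_max_of_lt_left (lt_of_le_of_ne (nrm_nonneg _) ?_)
          exact fun h => hv (shadow_eq_zero_and h.symm h2)
        · exact lt_max_of_lt_right (abs_pos.2 h2)
      refine ContinuousAt.div_const ?_ _
      refine Real.continuous_arccos.continuousAt.comp (ContinuousAt.div ?_ ?_ hm)
      · exact Continuous.continuousAt (by fun_prop)
      · exact Continuous.continuousAt (by fun_prop))
    (by
      intro v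
      refine ⟨div_nonneg (Real.arccos_nonneg _) hpi.le, ?_⟩
      rw [div_le_iff₀ hpi]
      have : 0 ≤ |v 2| / max (nrm (shadow v)) |v 2| :=
        div_nonneg (abs_nonneg _) (le_max_of_le_right (abs_nonneg _))
      linarith [Real.arccos_le_pi_div_two.2 this])
    (by
      intro v w c hc h1 h2
      simp only [h1, h2]
      rw [← mul_max_of_nonneg _ _ (abs_nonneg c), mul_div_mul_left _ _ (abs_ne_zero.2 hc)])
    (by
      intro u hu x hx
      simp only [shadow_withHeight, withHeight_apply_two, hx, hnr, div_one]
      have h0 : 0 ≤ a u :=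
        Real.cos_nonneg_of_mem_Icc ⟨by nlinarith [hu.1], by nlinarith [hu.2]⟩
      rw [abs_of_nonneg h0, max_eq_left (Real.cos_le_one _), div_one,
        Real.arccos_cos (by have := hu.1; positivity) (by nlinarith [hu.2])]
      field_simp)
  simp only [hnr, div_one] at hiso
  exact hiso.trans (ambientIsotopic_signed_line hd)

/-- A height profile over a curve `F` of unit vectors with `F (u + 1) = ±F u` that makes it an
unknot. -/
theorem exists_unknot_profile {F : ℝ → Fin 3 → ℝ} (hF : Differentiable ℝ F)
    (hn : ∀ u, nrm (F u) = 1) {ε : ℝ} (hε : ε = 1 ∨ ε = -1) (hper : ∀ u, F (u + 1) = ε • F u)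
    (hF' : ∀ u, LinearIndependent ℝ ![F u, deriv F u])
    (hpair : ∀ u ∈ Set.Ioo (0 : ℝ) (1 / 2), LinearIndependent ℝ ![F u, F (-u)]) :
    ∃ ζ : ℝ → ℝ, ContDiff ℝ ∞ ζ ∧ (∀ u, ζ (u + 1) = ε * ζ u) ∧
      StrictAntiOn ζ (Set.Ioo 0 (1 / 2)) ∧ (∀ u ∈ Set.Ioo (0 : ℝ) (1 / 2), 0 < ζ u) ∧
      (AmbientIsotopic (pointsOf {v | ∃ u ∈ Set.Icc (-(1 / 2) : ℝ) (1 / 2),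
          v = withHeight (F u) (ζ u)}) planarCircle ∨
        AmbientIsotopic (pointsOf {v | ∃ u ∈ Set.Icc (-(1 / 2) : ℝ) (1 / 2),
          v = withHeight (F u) (ζ u)}) projectiveLine) := by
  have hpi := Real.pi_pos
  rcases hε with rfl | rfl
  · have hpos : ∀ u, 0 < 5 - 4 * Real.cos (2 * Real.pi * u) := by
      intro u
      linarith [Real.cos_le_one (2 * Real.pi * u)]
    refine ⟨fun u => 1 / √(5 - 4 * Real.cos (2 * Real.pi * u)), ?_, ?_, ?_, ?_, Or.inl
      (ambientIsotopic_planarCircle hF hn (fun u => by rw [hper, one_smul]) hF' hpair)⟩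
    · refine contDiff_const.div ?_ fun u => (Real.sqrt_pos.2 (hpos u)).ne'
      refine ContDiff.sqrt ?_ fun u => (hpos u).ne'
      fun_prop
    · intro u
      have e : 2 * Real.pi * (u + 1) = 2 * Real.pi * u + 2 * Real.pi := by ring
      simp only [e, Real.cos_add_two_pi, one_mul]
    · intro x hx y hy hxy
      refine one_div_lt_one_div_of_lt (Real.sqrt_pos.2 (hpos x)) ?_
      refine Real.sqrt_lt_sqrt (hpos x).le ?_
      have := Real.cos_lt_cos_of_nonneg_of_le_pi (x := 2 * Real.pi * x) (y := 2 * Real.pi * y)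
        (by have := hx.1; positivity) (by nlinarith [hy.2]) (by nlinarith)
      linarith
    · intro u _
      exact one_div_pos.2 (Real.sqrt_pos.2 (hpos u))
  · refine ⟨fun u => Real.cos (Real.pi * u), by fun_prop, ?_, ?_, ?_, Or.inr
      (ambientIsotopic_projectiveLine hF hn (fun u => by rw [hper, neg_one_smul]) hF' hpair)⟩
    · intro u
      have e : Real.pi * (u + 1) = Real.pi * u + Real.pi := by ring
      simp only [e, Real.cos_add_pi, neg_one_mul]
    · intro x hx y hy hxy
      exact Real.cos_lt_cos_of_nonneg_of_le_pi (by have := hx.1; positivity)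
        (by nlinarith [hy.2]) (by nlinarith)
    · intro u hu
      exact Real.cos_pos_of_mem_Ioo ⟨by nlinarith [hu.1], by nlinarith [hu.2]⟩

/-! ### Reparametrization of the circle -/

/-- A diffeomorphism of the circle `ℝ / ℤ` that fixes `0` and contracts towards it. -/
def contraction (t : ℝ) : ℝ := t - (1 - Real.cos (2 * Real.pi * t)) / 10

theorem contDiff_contraction : ContDiff ℝ ∞ contraction := by
  unfold contraction
  fun_prop

theorem hasDerivAt_contraction (t : ℝ) :
    HasDerivAt contraction (1 - Real.sin (2 * Real.pi * t) * (2 * Real.pi) / 10) t := by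
  have h1 : HasDerivAt (fun u : ℝ => 2 * Real.pi * u) (2 * Real.pi) t := by
    simpa using (hasDerivAt_id t).const_mul (2 * Real.pi)
  have h2 : HasDerivAt contraction _ t :=
    (hasDerivAt_id t).sub ((h1.cos.const_sub 1).div_const 10)
  exact h2.congr_deriv (by ring)

/-- The coefficient `1/10` in `contraction` is small enough for this: `2π / 10 < 1`. -/
theorem deriv_contraction_pos (t : ℝ) :
    0 < 1 - Real.sin (2 * Real.pi * t) * (2 * Real.pi) / 10 := by
  have h1 := Real.sin_le_one (2 * Real.pi * t)
  have h2 := Real.pi_pos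
  have h3 := Real.pi_lt_four
  nlinarith

theorem strictMono_contraction : StrictMono contraction :=
  strictMono_of_deriv_pos fun t => by
    rw [(hasDerivAt_contraction t).deriv]; exact deriv_contraction_pos t

theorem contraction_add_one (t : ℝ) : contraction (t + 1) = contraction t + 1 := by
  have e : 2 * Real.pi * (t + 1) = 2 * Real.pi * t + 2 * Real.pi := by ring
  simp only [contraction, e, Real.cos_add_two_pi]
  ring

theorem contraction_zero : contraction 0 = 0 := by simp [contraction]

theorem surjective_contraction : Function.Surjective contraction := by
  refine contDiff_contraction.continuous.surjective ?_ ?_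
  · refine Filter.tendsto_atTop_mono (f := fun t => t - 1 / 5) (fun t => ?_)
      (Filter.tendsto_atTop_add_const_right _ _ Filter.tendsto_id)
    simp only [contraction]
    linarith [Real.neg_one_le_cos (2 * Real.pi * t)]
  · refine Filter.tendsto_atBot_mono (fun t => ?_) Filter.tendsto_id
    simp only [contraction, id]
    linarith [Real.cos_le_one (2 * Real.pi * t)]

/-- The iterates decrease and stay nonnegative, so they converge to a fixed point in `[0, 1)`. The
fixed points are the integers, so the limit is `0`. -/
theorem exists_iterate_contraction_lt {τ : ℝ} (h0 : 0 ≤ τ) (h1 : τ < 1) :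
    ∃ n : ℕ, contraction^[n] τ < 1 / 2 := by
  have hle : ∀ t, contraction t ≤ t := fun t => by
    simp only [contraction]
    linarith [Real.cos_le_one (2 * Real.pi * t)]
  have hanti : Antitone fun n : ℕ => contraction^[n] τ :=
    antitone_nat_of_succ_le fun n => by
      rw [Function.iterate_succ_apply']; exact hle _
  have hnn : ∀ n : ℕ, 0 ≤ contraction^[n] τ := by
    intro n
    induction n with
    | zero => exact h0
    | succ n ih =>
      rw [Function.iterate_succ_apply', ← contraction_zero]
      exact strictMono_contraction.monotone ih
  have hlim := tendsto_atTop_ciInf hanti ⟨0, by rintro _ ⟨n, rfl⟩; exact hnn n⟩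
  set L := ⨅ n : ℕ, contraction^[n] τ with hL
  have hfix : contraction L = L :=
    isFixedPt_of_tendsto_iterate hlim contDiff_contraction.continuous.continuousAt
  have hL0 : 0 ≤ L := ge_of_tendsto' hlim hnn
  have hL1 : L < 1 := (le_of_tendsto' hlim fun n => hanti (Nat.zero_le n)).trans_lt h1
  have hcos : Real.cos (2 * Real.pi * L) = 1 := by
    simp only [contraction] at hfix
    linarith
  have hLz : L = 0 := by
    obtain ⟨k, hk⟩ := (Real.cos_eq_one_iff _).1 hcos
    have hpi := Real.pi_pos
    have hkL : (k : ℝ) = L := by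
      have : 2 * Real.pi * (k - L) = 0 := by linear_combination hk
      have := (mul_eq_zero.1 this).resolve_left (by positivity)
      linarith
    have hk0 : 0 ≤ k := by exact_mod_cast hkL ▸ hL0
    have hk1 : k < 1 := by exact_mod_cast hkL ▸ hL1
    have : k = 0 := by omega
    rw [← hkL, this, Int.cast_zero]
  rw [hLz] at hlim
  exact (hlim.eventually (gt_mem_nhds (by norm_num : (0 : ℝ) < 1 / 2))).exists

theorem exists_reparametrization {τ : ℝ} (h0 : 0 ≤ τ) (h1 : τ < 1) :
    ∃ ρ : ℝ ≃ₜ ℝ, ContDiff ℝ ∞ ρ ∧ ContDiff ℝ ∞ ρ.symm ∧ StrictMono ρ ∧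
      (∀ t, ρ (t + 1) = ρ t + 1) ∧ ρ 0 = 0 ∧ ρ τ < 1 / 2 := by
  set κ : ℝ ≃ₜ ℝ := (StrictMono.orderIsoOfSurjective contraction strictMono_contraction
    surjective_contraction).toHomeomorph with hκ
  have hκc : ⇑κ = contraction := rfl
  have hκs : ContDiff ℝ ∞ κ.symm :=
    κ.contDiff_symm_deriv (fun t => (deriv_contraction_pos t).ne') hasDerivAt_contraction
      contDiff_contraction
  have key : ∀ n : ℕ, ∃ ρ : ℝ ≃ₜ ℝ, ContDiff ℝ ∞ ρ ∧ ContDiff ℝ ∞ ρ.symm ∧ StrictMono ρ ∧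
      (∀ t, ρ (t + 1) = ρ t + 1) ∧ ρ 0 = 0 ∧ ρ τ = contraction^[n] τ := by
    intro n
    induction n with
    | zero =>
      exact ⟨Homeomorph.refl ℝ, contDiff_id, contDiff_id, strictMono_id, fun t => rfl, rfl, rfl⟩
    | succ n ih =>
      obtain ⟨ρ, h1, h2, h3, h4, h5, h6⟩ := ih
      refine ⟨ρ.trans κ, contDiff_contraction.comp h1, h2.comp hκs,
        strictMono_contraction.comp h3, fun t => ?_, ?_, ?_⟩
      · simp only [Homeomorph.trans_apply, h4, hκc, contraction_add_one]
      · simp only [Homeomorph.trans_apply, h5, hκc, contraction_zero]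
      · simp only [Homeomorph.trans_apply, h6, hκc, Function.iterate_succ_apply']
  obtain ⟨n, hn⟩ := exists_iterate_contraction_lt h0 h1
  obtain ⟨ρ, h1, h2, h3, h4, h5, h6⟩ := key n
  exact ⟨ρ, h1, h2, h3, h4, h5, h6 ▸ hn⟩

/-! ### Counting sign changes -/

/-- By compactness infinitely many zeros would accumulate, and at the limit the function would
vanish without its zero being isolated. -/
theorem finite_zeros {g : ℝ → ℝ} (hg : Differentiable ℝ g) (hz : ∀ t, g t = 0 → deriv g t ≠ 0)
    (a b : ℝ) : {t | t ∈ Set.Icc a b ∧ g t = 0}.Finite := by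
  by_contra hinf
  obtain ⟨x, hx, hacc⟩ := Set.Infinite.exists_accPt_of_subset_isCompact hinf
    (isCompact_Icc (a := a) (b := b)) fun t ht => ht.1
  have hfr : ∃ᶠ t in nhdsWithin x {x}ᶜ, g t = 0 :=
    (accPt_iff_frequently_nhdsNE.1 hacc).mono fun t ht => ht.2
  have hx0 : g x = 0 := by
    by_contra hne
    exact hfr (((hg x).continuousAt.eventually_ne hne).filter_mono nhdsWithin_le_nhds)
  exact hfr ((hg x).hasDerivAt.eventually_ne (hz x hx0))

theorem pos_mul_of_no_zeros {g : ℝ → ℝ} (hg : Continuous g) {a b : ℝ} (hab : a ≤ b)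
    (h : ∀ t ∈ Set.Icc a b, g t ≠ 0) : 0 < g a * g b := by
  by_contra hcon
  have hne := mul_ne_zero (h a ⟨le_rfl, hab⟩) (h b ⟨hab, le_rfl⟩)
  have hlt : g a * g b < 0 := lt_of_le_of_ne (not_lt.1 hcon) hne
  rcases mul_neg_iff.1 hlt with ⟨h1, h2⟩ | ⟨h1, h2⟩
  · obtain ⟨t, ht, ht0⟩ := intermediate_value_Icc' hab hg.continuousOn ⟨h2.le, h1.le⟩
    exact h t ht ht0
  · obtain ⟨t, ht, ht0⟩ := intermediate_value_Icc hab hg.continuousOn ⟨h1.le, h2.le⟩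
    exact h t ht ht0

/-- A function all of whose zeros are simple changes its sign at each zero. -/
theorem even_ncard_zeros_iff {g : ℝ → ℝ} (hg : Differentiable ℝ g)
    (hz : ∀ t, g t = 0 → deriv g t ≠ 0) {a b : ℝ} (hab : a < b) (ha : g a ≠ 0) (hb : g b ≠ 0) :
    Even {t | t ∈ Set.Ioo a b ∧ g t = 0}.ncard ↔ 0 < g a * g b := by
  obtain ⟨n, hn⟩ : ∃ n, {t | t ∈ Set.Ioo a b ∧ g t = 0}.ncard = n := ⟨_, rfl⟩
  have hfin : ∀ b, {t | t ∈ Set.Ioo a b ∧ g t = 0}.Finite := fun b =>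
    (finite_zeros hg hz a b).subset fun t ht => ⟨Set.Ioo_subset_Icc_self ht.1, ht.2⟩
  induction n generalizing b with
  | zero =>
    have hemp := (Set.ncard_eq_zero (hfin b)).1 hn
    have := pos_mul_of_no_zeros hg.continuous hab.le fun t ht h0 => by
      have hta : a ≠ t := by rintro rfl; exact ha h0
      have htb : t ≠ b := by rintro rfl; exact hb h0
      have : t ∈ {t | t ∈ Set.Ioo a b ∧ g t = 0} :=
        ⟨⟨lt_of_le_of_ne ht.1 hta, lt_of_le_of_ne ht.2 htb⟩, h0⟩
      rw [hemp] at this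
      exact this
    rw [hn]
    exact iff_of_true Even.zero this
  | succ n ih =>
    have hne : {t | t ∈ Set.Ioo a b ∧ g t = 0}.Nonempty := by
      rw [← Set.ncard_pos (hfin b), hn]; omega
    -- Induction on the number of zeros removes the largest one, `m`. Points `c < m < e` close to it
    -- are chosen so that `g` has the sign of `-g' m` on `[c, m)` and of `g' m` at `e`.
    obtain ⟨m, ⟨hm, hm0⟩, hmax⟩ := Set.exists_max_image _ id (hfin b) hne
    have hd := hz m hm0
    have hslope : ∀ᶠ x in nhdsWithin m {m}ᶜ, 0 < slope g m x * deriv g m :=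
      ((hasDerivAt_iff_tendsto_slope.1 (hg m).hasDerivAt).mul_const (deriv g m)).eventually
        (lt_mem_nhds (mul_self_pos.2 hd))
    obtain ⟨l, r, hlr, hsub⟩ := mem_nhdsWithin_iff_exists_mem_nhds_inter.1 hslope |> fun ⟨u, hu, h⟩ =>
      let ⟨l, r, h1, h2⟩ := mem_nhds_iff_exists_Ioo_subset.1 hu
      (⟨l, r, h1, fun x hx => h ⟨h2 hx.1, hx.2⟩⟩ :
        ∃ l r, m ∈ Set.Ioo l r ∧ Set.Ioo l r ∩ {m}ᶜ ⊆ {x | 0 < slope g m x * deriv g m})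
    obtain ⟨c, hc1, hc2⟩ := exists_between (max_lt hm.1 hlr.1)
    obtain ⟨e, he1, he2⟩ := exists_between (lt_min hm.2 hlr.2)
    obtain ⟨hca, hcl⟩ := max_lt_iff.1 hc1
    obtain ⟨heb, her⟩ := lt_min_iff.1 he2
    have hsl : ∀ x, slope g m x = (x - m)⁻¹ * g x := by
      intro x; simp [slope, hm0]
    have hleft : ∀ x ∈ Set.Ico c m, g x * deriv g m < 0 := by
      intro x hx
      have h1 : 0 < slope g m x * deriv g m :=
        hsub ⟨⟨by linarith [hx.1], by linarith [hx.2, hlr.2]⟩, hx.2.ne⟩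
      rw [hsl, mul_assoc] at h1
      have h2 : (x - m)⁻¹ < 0 := inv_lt_zero.2 (by linarith [hx.2])
      by_contra hcon
      exact absurd h1 (not_lt.2 (mul_nonpos_of_nonpos_of_nonneg h2.le (not_lt.1 hcon)))
    have hright : 0 < g e * deriv g m := by
      have h1 : 0 < slope g m e * deriv g m :=
        hsub ⟨⟨by linarith [hlr.1], her⟩, he1.ne'⟩
      rw [hsl, mul_assoc] at h1
      have h2 : 0 < (e - m)⁻¹ := inv_pos.2 (by linarith)
      exact (pos_iff_pos_of_mul_pos h1).1 h2
    have hgc := hleft c ⟨le_rfl, hc2⟩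
    have hgc0 : g c ≠ 0 := by rintro h; simp [h] at hgc
    have heb' : 0 < g e * g b := pos_mul_of_no_zeros hg.continuous heb.le fun t ht h0 => by
      have htb : t ≠ b := by rintro rfl; exact hb h0
      have := hmax t ⟨⟨by linarith [hm.1, ht.1], lt_of_le_of_ne ht.2 htb⟩, h0⟩
      simp only [id] at this
      linarith [ht.1]
    have hset : {t | t ∈ Set.Ioo a b ∧ g t = 0} =
        insert m {t | t ∈ Set.Ioo a c ∧ g t = 0} := by
      ext t
      constructor
      · rintro ⟨ht, ht0⟩
        have htm : t ≤ m := hmax t ⟨ht, ht0⟩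
        rcases htm.eq_or_lt with rfl | htm
        · exact Set.mem_insert _ _
        · refine Set.mem_insert_of_mem _ ⟨⟨ht.1, ?_⟩, ht0⟩
          by_contra hcon
          have := hleft t ⟨not_lt.1 hcon, htm⟩
          simp [ht0] at this
      · rintro (rfl | ⟨ht, ht0⟩)
        · exact ⟨hm, hm0⟩
        · exact ⟨⟨ht.1, by linarith [ht.2, hm.2]⟩, ht0⟩
    have hcard : {t | t ∈ Set.Ioo a c ∧ g t = 0}.ncard = n := by
      have hnot : m ∉ {t | t ∈ Set.Ioo a c ∧ g t = 0} := fun h => by linarith [h.1.2]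
      rw [hset, Set.ncard_insert_of_notMem hnot (hfin c)] at hn
      omega
    have hIH := ih hca hgc0 hcard
    rw [hcard] at hIH
    -- There is no zero in `[e, b]`, so `g b` has the sign of `g e`, opposite to that of `g c`.
    have hcb : g c * g b < 0 := by
      have h1 : (g c * g b) * (g e * deriv g m) ^ 2 < 0 := by
        have : (g c * g b) * (g e * deriv g m) ^ 2 =
            (g c * deriv g m) * ((g e * deriv g m) * (g e * g b)) := by ring
        rw [this]
        exact mul_neg_of_neg_of_pos hgc (mul_pos hright heb')
      by_contra hcon
      nlinarith [mul_nonneg (not_lt.1 hcon) (sq_nonneg (g e * deriv g m))]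
    rw [hn, Nat.even_add_one, not_congr hIH]
    have hprod : (g a * g c) * (g a * g b) < 0 := by
      have : (g a * g c) * (g a * g b) = g a ^ 2 * (g c * g b) := by ring
      rw [this]
      exact mul_neg_of_pos_of_neg (by positivity) hcb
    constructor
    · intro h
      by_contra hcon
      nlinarith [mul_nonneg_of_nonpos_of_nonpos (not_lt.1 h) (not_lt.1 hcon)]
    · intro h hcon
      linarith [mul_pos hcon h]

/-! ### Travelling along the circle -/

open KnotDiagram

theorem travel_zero (o : ℤˣ) (b : UnitAddCircle) : travel o b 0 = b := by
  simp [travel]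

theorem travel_eq_coe (o : ℤˣ) (β t : ℝ) :
    travel o (β : UnitAddCircle) t = ((β + ((o : ℤ) : ℝ) * t : ℝ) : UnitAddCircle) := by
  rw [travel, AddCircle.coe_add, ← zsmul_eq_mul, AddCircle.coe_zsmul]

theorem travel_eq_travel_iff (o : ℤˣ) (b : UnitAddCircle) (s t : ℝ) :
    travel o b s = travel o b t ↔ ∃ n : ℤ, s = t + n := by
  have h1 : (s : UnitAddCircle) = t ↔ ∃ n : ℤ, s = t + n := by
    rw [← sub_eq_zero, ← AddCircle.coe_sub, AddCircle.coe_eq_zero_iff]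
    refine exists_congr fun n => ?_
    rw [zsmul_eq_mul, mul_one]
    constructor <;> intro h <;> linarith
  rw [← h1, travel, travel, add_right_inj]
  rcases Int.units_eq_one_or o with rfl | rfl <;> simp

theorem exists_travel_eq (o : ℤˣ) (b x : UnitAddCircle) : ∃ t ∈ Set.Ico (0 : ℝ) 1,
    travel o b t = x := by
  obtain ⟨t, ht, h⟩ := AddCircle.eq_coe_Ico (p := (1 : ℝ)) ((o : ℤ) • (x - b))
  refine ⟨t, ht, ?_⟩
  rw [travel, h]
  rcases Int.units_eq_one_or o with rfl | rfl <;> simp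

theorem travel_add_one (o : ℤˣ) (b : UnitAddCircle) (t : ℝ) : travel o b (t + 1) = travel o b t :=
  (travel_eq_travel_iff o b _ _).2 ⟨1, by simp⟩

theorem travel_injOn (o : ℤˣ) (b : UnitAddCircle) : Set.InjOn (travel o b) (Set.Ico 0 1) := by
  intro s hs t ht h
  obtain ⟨n, hn⟩ := (travel_eq_travel_iff o b s t).1 h
  have h1 : (n : ℝ) < 1 := by linarith [hs.2, ht.1]
  have h2 : (-1 : ℝ) < n := by linarith [hs.1, ht.2]
  have h1' : n < 1 := by exact_mod_cast h1
  have h2' : -1 < n := by exact_mod_cast h2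
  have : n = 0 := by omega
  simpa [this] using hn

/-! ### Unit lifts -/

theorem mk_mem_lineAtInfinity {v : Fin 3 → ℝ} (hv : v ≠ 0) :
    (Projectivization.mk ℝ v hv : RP 2) ∈ lineAtInfinity ↔ v 2 = 0 := by
  obtain ⟨c, hc⟩ := Projectivization.exists_smul_eq_mk_rep ℝ v hv
  have hc0 : (c : ℝ) ≠ 0 := c.ne_zero
  change (Projectivization.mk ℝ v hv).rep 2 = 0 ↔ v 2 = 0
  rw [← hc, Units.smul_def, Pi.smul_apply, smul_eq_mul, mul_eq_zero, or_iff_right hc0]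

theorem height_mk {x : Fin 3 → ℝ} {z : ℝ} (h : withHeight x z ≠ 0) :
    height (Projectivization.mk ℝ (withHeight x z) h) = z / x 2 := by
  obtain ⟨c, hc⟩ := Projectivization.exists_smul_eq_mk_rep ℝ _ h
  have hc0 : (c : ℝ) ≠ 0 := c.ne_zero
  rw [height, ← hc, Units.smul_def, Pi.smul_apply, Pi.smul_apply, smul_eq_mul, smul_eq_mul,
    mul_div_mul_left _ _ hc0]
  rfl

theorem ne_zero_of_nrm {x : Fin 3 → ℝ} (h : nrm x = 1) : x ≠ 0 := by
  rintro rfl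
  rw [nrm_zero] at h
  exact zero_ne_one h

theorem eq_or_eq_neg_of_mk_eq {x y : Fin 3 → ℝ} (hx : nrm x = 1) (hy : nrm y = 1) {hx0 : x ≠ 0}
    {hy0 : y ≠ 0} (h : Projectivization.mk ℝ x hx0 = Projectivization.mk ℝ y hy0) :
    ∃ e : ℝ, (e = 1 ∨ e = -1) ∧ x = e • y := by
  obtain ⟨e, he⟩ := (Projectivization.mk_eq_mk_iff' ℝ _ _ _ _).1 h
  refine ⟨e, ?_, he.symm⟩
  have := nrm_smul e y
  rw [he, hx, hy, mul_one] at this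
  exact eq_or_eq_neg_of_abs_eq this.symm

/-- Smooth homogeneous coordinates of norm `1` of a diagram, for the parameter of a traveller. -/
structure IsUnitLift (D : KnotDiagram) (o : ℤˣ) (b : UnitAddCircle) (G : ℝ → Fin 3 → ℝ) :
    Prop where
  contDiff : ContDiff ℝ ∞ G
  nrm_eq : ∀ t, nrm (G t) = 1
  curve_eq : ∀ t (h : G t ≠ 0), D.curve (travel o b t) = Projectivization.mk ℝ (G t) h
  immersion : ∀ t, LinearIndependent ℝ ![G t, deriv G t]
  transverse : ∀ t, G t 2 = 0 → deriv (fun t => G t 2) t ≠ 0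
  pos : 0 < G 0 2

theorem exists_isUnitLift {D : KnotDiagram} (o : ℤˣ) {b : UnitAddCircle} (hb : D.IsBasepoint b) :
    ∃ G, IsUnitLift D o b G := by
  obtain ⟨F, ⟨hF, hFc⟩, himm, -, htr⟩ := D.generic.exists_lift
  obtain ⟨β, -, rfl⟩ := AddCircle.eq_coe_Ico b
  set r : ℝ := ((o : ℤ) : ℝ) with hr
  have hr2 : r * r = 1 := by
    rcases Int.units_eq_one_or o with h | h <;> simp [hr, h]
  have hr0 : r ≠ 0 := sign_ne_zero hr2
  have hF0 : ∀ t, F t ≠ 0 := fun t => (hFc t).1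
  have hnpos : ∀ t, 0 < nrm (F t) := fun t => nrm_pos (hF0 t)
  have hw : F β 2 ≠ 0 := by
    intro h
    apply hb.2
    obtain ⟨h0, h1⟩ := hFc β
    rw [h1, mk_mem_lineAtInfinity]
    exact h
  -- The global sign that makes the last coordinate positive at the basepoint; it is nonzero there
  -- because the basepoint is off the line at infinity.
  set η : ℝ := F β 2 / |F β 2| with hη
  have hη2 : |η| = 1 := by
    rw [hη, abs_div, abs_abs, div_self (abs_ne_zero.2 hw)]
  have hη0 : η ≠ 0 := by
    intro h; rw [h] at hη2; simp at hη2
  set l : ℝ → ℝ := fun t => η / nrm (F t) with hl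
  have hl0 : ∀ t, l t ≠ 0 := fun t => div_ne_zero hη0 (hnpos t).ne'
  have hnC : ContDiff ℝ ∞ fun t => nrm (F t) := by
    have hFi : ∀ i, ContDiff ℝ ∞ fun t => F t i := fun i => contDiff_pi.1 hF i
    unfold nrm
    refine ContDiff.sqrt ?_ fun t => ?_
    · exact (((hFi 0).pow 2).add ((hFi 1).pow 2)).add ((hFi 2).pow 2)
    · rw [← nrm_sq]; exact pow_ne_zero 2 (hnpos t).ne'
  have hlC : ContDiff ℝ ∞ l := contDiff_const.div hnC fun t => (hnpos t).ne'
  set E : ℝ → Fin 3 → ℝ := fun t => l t • F t with hE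
  have hEC : ContDiff ℝ ∞ E := hlC.smul hF
  have hld : Differentiable ℝ l := hlC.differentiable (by simp)
  have hFd : Differentiable ℝ F := hF.differentiable (by simp)
  have hEd : Differentiable ℝ E := hEC.differentiable (by simp)
  have hEderiv : ∀ t, deriv E t = l t • deriv F t + deriv l t • F t := fun t =>
    ((hld t).hasDerivAt.smul (hFd t).hasDerivAt).deriv
  set φ : ℝ → ℝ := fun t => β + r * t with hφ
  have hφd : ∀ t, HasDerivAt φ r t := fun t =>
    (((hasDerivAt_id t).const_mul r).const_add β).congr_deriv (mul_one r)
  have hGd : ∀ t, HasDerivAt (fun t => E (φ t)) (r • deriv E (φ t)) t := fun t =>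
    (hEd (φ t)).hasDerivAt.scomp t (hφd t)
  refine ⟨fun t => E (φ t), ?_, ?_, ?_, ?_, ?_, ?_⟩
  · exact hEC.comp (by simp only [hφ]; fun_prop)
  · intro t
    simp only [hE, hl]
    rw [nrm_smul, abs_div, hη2, abs_of_pos (hnpos _), one_div, inv_mul_cancel₀ (hnpos _).ne']
  · intro t h
    obtain ⟨h0, h1⟩ := hFc (φ t)
    rw [travel_eq_coe, h1, eq_comm, Projectivization.mk_eq_mk_iff']
    exact ⟨l (φ t), rfl⟩
  · intro t
    refine linearIndependent_pair_of_combination (himm (φ t)) (l (φ t)) 0 (r * deriv l (φ t))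
      (r * l (φ t)) ?_ ?_ ?_
    · simp [hE]
    · rw [(hGd t).deriv, hEderiv]; module
    · have := hl0 (φ t)
      simp [this, hr0]
  · intro t ht
    have hF2 : F (φ t) 2 = 0 := by
      have : l (φ t) * F (φ t) 2 = 0 := ht
      exact (mul_eq_zero.1 this).resolve_left (hl0 _)
    have hd : HasDerivAt (fun t => E (φ t) 2) ((r • deriv E (φ t)) 2) t :=
      hasDerivAt_pi.1 (hGd t) 2
    rw [hd.deriv, hEderiv]
    simp only [Pi.smul_apply, Pi.add_apply, smul_eq_mul, hF2, mul_zero, add_zero]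
    exact mul_ne_zero hr0 (mul_ne_zero (hl0 _) (htr _ hF2))
  · have e : φ 0 = β := by simp [hφ]
    have : E (φ 0) 2 = |F β 2| / nrm (F β) := by
      simp only [e, hE, hl, hη, Pi.smul_apply, smul_eq_mul]
      have := abs_ne_zero.2 hw
      have h3 := (hnpos β).ne'
      field_simp
      rw [sq_abs]
    simp only [this]
    exact div_pos (abs_pos.2 hw) (hnpos β)

namespace IsUnitLift

variable {D : KnotDiagram} {o : ℤˣ} {b : UnitAddCircle} {G : ℝ → Fin 3 → ℝ}

theorem ne_zero (hG : IsUnitLift D o b G) (t : ℝ) : G t ≠ 0 := ne_zero_of_nrm (hG.nrm_eq t)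

theorem eq_or_eq_neg (hG : IsUnitLift D o b G) {s t : ℝ}
    (h : D.curve (travel o b s) = D.curve (travel o b t)) :
    ∃ e : ℝ, (e = 1 ∨ e = -1) ∧ G s = e • G t := by
  rw [hG.curve_eq s (hG.ne_zero s), hG.curve_eq t (hG.ne_zero t)] at h
  exact eq_or_eq_neg_of_mk_eq (hG.nrm_eq s) (hG.nrm_eq t) h

theorem linearIndependent_of_ne (hG : IsUnitLift D o b G) {s t : ℝ}
    (h : D.curve (travel o b s) ≠ D.curve (travel o b t)) :
    LinearIndependent ℝ ![G s, G t] := by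
  rw [LinearIndependent.pair_iff' (hG.ne_zero s)]
  intro a ha
  apply h
  rw [hG.curve_eq s (hG.ne_zero s), hG.curve_eq t (hG.ne_zero t), eq_comm,
    Projectivization.mk_eq_mk_iff']
  exact ⟨a, ha⟩

/-- The inner product of `G (t + 1)` and `G t` is continuous with values `±1`, so the sign is the
same for all `t`. -/
theorem exists_period (hG : IsUnitLift D o b G) :
    ∃ ε : ℝ, (ε = 1 ∨ ε = -1) ∧ ∀ t, G (t + 1) = ε • G t := by
  have hstep : ∀ t, ∃ e : ℝ, (e = 1 ∨ e = -1) ∧ G (t + 1) = e • G t := fun t =>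
    hG.eq_or_eq_neg (by rw [travel_add_one])
  set h : ℝ → ℝ := fun t => G (t + 1) 0 * G t 0 + G (t + 1) 1 * G t 1 + G (t + 1) 2 * G t 2 with hh
  have hcont : Continuous h := by
    have hc := hG.contDiff.continuous
    simp only [hh]
    fun_prop
  have hval : ∀ t e, G (t + 1) = e • G t → h t = e := by
    intro t e he
    have := nrm_sq (G t)
    rw [hG.nrm_eq] at this
    simp only [hh, he, Pi.smul_apply, smul_eq_mul]
    linear_combination -e * this
  obtain ⟨ε, hε, hε0⟩ := hstep 0
  refine ⟨ε, hε, fun t => ?_⟩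
  obtain ⟨e, he, het⟩ := hstep t
  have hne : ∀ x, h x ≠ 0 := by
    intro x hx
    obtain ⟨e, he, hex⟩ := hstep x
    rw [hval x e hex] at hx
    rcases he with rfl | rfl <;> norm_num at hx
  have hsame : 0 < h 0 * h t := by
    rcases le_total 0 t with h0 | h0
    · exact pos_mul_of_no_zeros hcont h0 fun x _ => hne x
    · rw [mul_comm]
      exact pos_mul_of_no_zeros hcont h0 fun x _ => hne x
  rw [hval 0 ε hε0, hval t e het] at hsame
  have : e = ε := by
    rcases he with rfl | rfl <;> rcases hε with rfl | rfl <;>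
      first | rfl | (exfalso; norm_num at hsame)
  rw [het, this]

theorem mem_lineAtInfinity_iff (hG : IsUnitLift D o b G) (t : ℝ) :
    D.curve (travel o b t) ∈ lineAtInfinity ↔ G t 2 = 0 := by
  rw [hG.curve_eq t (hG.ne_zero t), mk_mem_lineAtInfinity]

/-- The sign of the last coordinate gives the parity of the arc distance. -/
theorem even_arcDistance_iff (hG : IsUnitLift D o b G) {t : ℝ} (ht : 0 < t) (h : G t 2 ≠ 0) :
    Even (D.arcDistance o b t) ↔ 0 < G t 2 := by
  have hd : Differentiable ℝ fun t => G t 2 :=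
    (contDiff_pi.1 hG.contDiff 2).differentiable (by simp)
  have := even_ncard_zeros_iff hd hG.transverse ht hG.pos.ne' h
  rw [arcDistance]
  simp only [hG.mem_lineAtInfinity_iff]
  rw [this, mul_pos_iff_of_pos_left hG.pos]

end IsUnitLift

/-! ### Crossings -/

theorem finite_setOf_curve_mem_crossings (D : KnotDiagram) :
    {x | D.curve x ∈ D.crossings}.Finite := by
  refine Set.Finite.preimage' D.generic.finite_doublePoints ?_
  rintro P ⟨s, t, hst, hs, ht⟩
  refine (Set.toFinite {s, t}).subset fun r hr => ?_
  rcases D.generic.no_triple r s t (hr.trans hs.symm) (hs.trans ht.symm) with h | h | h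
  · exact Or.inl h
  · exact absurd h hst
  · exact Or.inr h

theorem exists_last_crossing (D : KnotDiagram) (o : ℤˣ) (b : UnitAddCircle) :
    ∃ τ, 0 ≤ τ ∧ τ < 1 ∧
      ∀ t ∈ Set.Ico (0 : ℝ) 1, D.curve (travel o b t) ∈ D.crossings → t ≤ τ := by
  set T : Set ℝ := {t | t ∈ Set.Ico (0 : ℝ) 1 ∧ D.curve (travel o b t) ∈ D.crossings} with hT
  have hfin : T.Finite := by
    refine Set.Finite.of_finite_image (f := travel o b) ?_ ?_
    · exact (finite_setOf_curve_mem_crossings D).subset (by rintro _ ⟨t, ht, rfl⟩; exact ht.2)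
    · exact (travel_injOn o b).mono fun t ht => ht.1
  rcases T.eq_empty_or_nonempty with h | h
  -- Without crossings any time will do.
  · refine ⟨0, le_rfl, one_pos, fun t ht h' => ?_⟩
    have : t ∈ T := ⟨ht, h'⟩
    rw [h] at this
    exact this.elim
  · obtain ⟨τ, hτ, hmax⟩ := Set.exists_max_image T id hfin h
    exact ⟨τ, hτ.1.1, hτ.1.2, fun t ht h' => hmax t ⟨ht, h'⟩⟩

/-- If the curve of a diagram lifts to a knot, then suitable crossing changes turn the diagram into a
diagram of this knot. -/
theorem exists_changeCrossings_isDiagramOf (D : KnotDiagram) (K : Knot)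
    (hK : ∀ t, ProjectsTo (K.toFun t) (D.curve t))
    (hne : ∀ s t, s ≠ t → D.curve s = D.curve t → height (K.toFun s) ≠ height (K.toFun t)) :
    ∃ S : Finset (RP 2), (S : Set (RP 2)) ⊆ D.crossings ∧ (D.changeCrossings S).IsDiagramOf K := by
  -- The crossings to change are those whose present overpass comes from the lower point of the
  -- knot.
  set S₀ : Set (RP 2) := {P | ∃ s t, s ≠ t ∧ D.curve s = P ∧ D.curve t = P ∧ s ∈ D.overpasses ∧
    height (K.toFun s) < height (K.toFun t)} with hS₀
  have hsub : S₀ ⊆ D.crossings := by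
    rintro P ⟨s, t, hst, hs, ht, -⟩
    exact ⟨s, t, hst, hs, ht⟩
  have hfin : S₀.Finite := D.generic.finite_doublePoints.subset hsub
  refine ⟨hfin.toFinset, by simpa using hsub, hK, ?_⟩
  intro s t hst hc
  change D.curve s = D.curve t at hc
  have hmem : ∀ s t, s ≠ t → D.curve s = D.curve t → s ∈ D.overpasses →
      (D.curve s ∈ S₀ ↔ height (K.toFun s) < height (K.toFun t)) := by
    intro s t hst hc hs
    refine ⟨?_, fun h => ⟨s, t, hst, rfl, hc.symm, hs, h⟩⟩
    rintro ⟨s', t', hst', hs', ht', hso, h⟩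
    have htn := (D.overpasses_iff s t hst hc).1 hs
    have e1 : s' = s := by
      rcases D.generic.no_triple s' s t hs' hc with h | h | h
      · exact h
      · exact absurd h hst
      · exact absurd (h ▸ hso) htn
    subst e1
    have e2 : t' = t := by
      rcases D.generic.no_triple t' s' t ht' hc with h | h | h
      · exact absurd h.symm hst'
      · exact absurd h hst
      · exact h
    rwa [← e2]
  have hcr : D.curve s ∈ D.crossings := ⟨s, t, hst, rfl, hc.symm⟩
  change (D.curve s ∈ D.crossings ∧ (s ∈ D.overpasses ↔ D.curve s ∉ (hfin.toFinset : Set (RP 2)))) ↔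
    _
  rw [Set.Finite.coe_toFinset]
  have hx := D.overpasses_iff s t hst hc
  have hne' := hne s t hst hc
  by_cases hs : s ∈ D.overpasses
  · have := hmem s t hst hc hs
    simp only [hcr, hs, this, true_and, true_iff, not_lt]
    exact ⟨fun h => lt_of_le_of_ne h hne'.symm, le_of_lt⟩
  · have ht : t ∈ D.overpasses := by
      by_contra h; exact hs (hx.2 h)
    have := hmem t s hst.symm hc.symm ht
    rw [← hc] at this
    simp only [hcr, hs, this, true_and, false_iff, not_not]

/-- Every diagram has a basepoint. -/
theorem exists_isBasepoint (D : KnotDiagram) : ∃ b, D.IsBasepoint b := by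
  obtain ⟨F, ⟨hF, hFc⟩, -, -, htr⟩ := D.generic.exists_lift
  have hFd : Differentiable ℝ F := hF.differentiable (by simp)
  have hd : ∀ t, HasDerivAt (fun t => F t 2) (deriv F t 2) t := fun t =>
    hasDerivAt_pi.1 (hFd t).hasDerivAt 2
  have hz := finite_zeros (g := fun t => F t 2) (fun t => (hd t).differentiableAt)
    (fun t ht => by rw [(hd t).deriv]; exact htr t ht) 0 1
  have hinj : Set.InjOn (fun t : ℝ => (t : UnitAddCircle)) (Set.Ico 0 1) := by
    intro s hs t ht h
    exact (AddCircle.coe_eq_coe_iff_of_mem_Ico (p := (1 : ℝ)) (a := 0) (by simpa using hs)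
      (by simpa using ht)).1 h
  have hcr : {t | t ∈ Set.Ico (0 : ℝ) 1 ∧ D.curve (t : UnitAddCircle) ∈ D.crossings}.Finite := by
    refine Set.Finite.of_finite_image (f := fun t : ℝ => (t : UnitAddCircle)) ?_ ?_
    · exact (finite_setOf_curve_mem_crossings D).subset (by rintro _ ⟨t, ht, rfl⟩; exact ht.2)
    · exact hinj.mono fun t ht => ht.1
  obtain ⟨t, ht, hnot⟩ := (Set.Ico_infinite (zero_lt_one' ℝ)).exists_notMem_finite (hz.union hcr)
  refine ⟨t, fun h => hnot (Or.inr ⟨ht, h⟩), fun h => hnot (Or.inl ⟨⟨ht.1, ht.2.le⟩, ?_⟩)⟩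
  obtain ⟨h0, h1⟩ := hFc t
  rwa [h1, mk_mem_lineAtInfinity] at h

/-! ### Knots over a diagram -/

theorem hasDerivAt_withHeight {G : ℝ → Fin 3 → ℝ} {z : ℝ → ℝ} {G' : Fin 3 → ℝ} {z' t : ℝ}
    (hG : HasDerivAt G G' t) (hz : HasDerivAt z z' t) :
    HasDerivAt (fun t => withHeight (G t) (z t)) (withHeight G' z') t := by
  rw [hasDerivAt_pi] at hG ⊢
  intro i
  fin_cases i
  exacts [hG 0, hG 1, hz, hG 2]

theorem contDiff_withHeight {G : ℝ → Fin 3 → ℝ} {z : ℝ → ℝ} (hG : ContDiff ℝ ∞ G)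
    (hz : ContDiff ℝ ∞ z) : ContDiff ℝ ∞ fun t => withHeight (G t) (z t) := by
  rw [contDiff_pi] at hG ⊢
  intro i
  fin_cases i
  exacts [hG 0, hG 1, hz, hG 2]

theorem linearIndependent_withHeight {x y : Fin 3 → ℝ} (h : LinearIndependent ℝ ![x, y])
    (z w : ℝ) : LinearIndependent ℝ ![withHeight x z, withHeight y w] := by
  rw [LinearIndependent.pair_iff] at h ⊢
  intro s t hst
  refine h s t ?_
  have h0 := congrFun hst 0
  have h1 := congrFun hst 1
  have h2 := congrFun hst 3
  ext i
  fin_cases i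
  exacts [h0, h1, h2]

/-- A height function over a unit lift gives a closed curve in `RP 3`; it is a knot if the two
branches of each crossing are at different heights. -/
theorem IsUnitLift.exists_knot {D : KnotDiagram} {o : ℤˣ} {b : UnitAddCircle} {G : ℝ → Fin 3 → ℝ}
    (hG : IsUnitLift D o b G) {ε : ℝ} (hper : ∀ t, G (t + 1) = ε • G t) {z : ℝ → ℝ}
    (hz : ContDiff ℝ ∞ z) (hzper : ∀ t, z (t + 1) = ε * z t)
    (hne : ∀ s ∈ Set.Ico (0 : ℝ) 1, ∀ t ∈ Set.Ico (0 : ℝ) 1, s < t →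
      D.curve (travel o b s) = D.curve (travel o b t) → z s / G s 2 ≠ z t / G t 2) :
    ∃ K : Knot, (∀ t, ProjectsTo (K.toFun t) (D.curve t)) ∧
      ∀ t, K.toFun (travel o b t) =
        Projectivization.mk ℝ (withHeight (G t) (z t)) (withHeight_ne_zero (hG.ne_zero t) _) := by
  obtain ⟨β, -, hβ⟩ := AddCircle.eq_coe_Ico b
  set r : ℝ := ((o : ℤ) : ℝ) with hr
  have hrcase : r = 1 ∨ r = -1 := by
    rcases Int.units_eq_one_or o with h | h <;> simp [hr, h]
  have hr2 : r * r = 1 := by rcases hrcase with h | h <;> rw [h] <;> norm_num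
  have hr0 : r ≠ 0 := sign_ne_zero hr2
  set κ : ℝ → RP 3 := fun t =>
    Projectivization.mk ℝ (withHeight (G t) (z t)) (withHeight_ne_zero (hG.ne_zero t) _) with hκ
  have hκ1 : ∀ t, κ (t + 1) = κ t := by
    intro t
    refine (Projectivization.mk_eq_mk_iff' ℝ _ _ _ _).2 ⟨ε, ?_⟩
    rw [smul_withHeight, hper, hzper]
  -- As `r * r = 1`, the map `t ↦ r * (t - β)` turns a coordinate on the circle back into the
  -- traveller's time.
  have hfper : Function.Periodic (fun t => κ (r * (t - β))) 1 := by
    intro t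
    rcases hrcase with h | h
    · simp only [h]
      rw [show (1 : ℝ) * (t + 1 - β) = 1 * (t - β) + 1 by ring, hκ1]
    · simp only [h]
      rw [← hκ1]
      congr 1
      ring
  have hlift : ∀ t, (hfper.lift : UnitAddCircle → RP 3) (travel o b t) = κ t := by
    intro t
    rw [← hβ, travel_eq_coe]
    change κ (r * (β + r * t - β)) = κ t
    congr 1
    linear_combination t * hr2
  have hproj : ∀ t, ProjectsTo (κ t) (D.curve (travel o b t)) := by
    intro t
    refine ⟨withHeight (G t) (z t), withHeight_ne_zero (hG.ne_zero t) _, ?_, rfl, ?_⟩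
    · change shadow (withHeight (G t) (z t)) ≠ 0
      rw [shadow_withHeight]
      exact hG.ne_zero t
    · have h := hG.curve_eq t (hG.ne_zero t)
      rw [h, Projectivization.mk_eq_mk_iff']
      refine ⟨1, ?_⟩
      change (1 : ℝ) • shadow (withHeight (G t) (z t)) = _
      rw [shadow_withHeight, one_smul]
  have hsm : IsSmoothImmersion (hfper.lift : UnitAddCircle → RP 3) := by
    have hL := contDiff_withHeight hG.contDiff hz
    have hφ : ∀ t, HasDerivAt (fun t => r * (t - β)) r t := fun t =>
      (((hasDerivAt_id t).sub_const β).const_mul r).congr_deriv (mul_one r)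
    refine ⟨fun t => withHeight (G (r * (t - β))) (z (r * (t - β))), ⟨?_, fun t => ?_⟩, fun t => ?_⟩
    · exact hL.comp (f := fun t => r * (t - β)) (by fun_prop)
    · exact ⟨withHeight_ne_zero (hG.ne_zero _) _, rfl⟩
    · have hGd : Differentiable ℝ G := hG.contDiff.differentiable (by simp)
      have hzd : Differentiable ℝ z := hz.differentiable (by simp)
      have h1 := (hasDerivAt_withHeight (hGd (r * (t - β))).hasDerivAt
        (hzd (r * (t - β))).hasDerivAt).scomp t (hφ t)
      have h2 : deriv (fun t => withHeight (G (r * (t - β))) (z (r * (t - β)))) t = _ := h1.deriv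
      rw [h2]
      refine linearIndependent_pair_of_combination
        (linearIndependent_withHeight (hG.immersion (r * (t - β))) (z (r * (t - β)))
          (deriv z (r * (t - β)))) 1 0 0 r (by module) (by module) ?_
      simpa using hr0
  refine ⟨⟨hfper.lift, hsm, ?_⟩, ?_, hlift⟩
  · have hlt : ∀ s ∈ Set.Ico (0 : ℝ) 1, ∀ t ∈ Set.Ico (0 : ℝ) 1, s < t → κ s ≠ κ t := by
      intro s hs t ht hst h
      have hc : D.curve (travel o b s) = D.curve (travel o b t) := by
        rw [hG.curve_eq s (hG.ne_zero s), hG.curve_eq t (hG.ne_zero t),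
          Projectivization.mk_eq_mk_iff']
        obtain ⟨a, ha⟩ := (Projectivization.mk_eq_mk_iff' ℝ _ _ _ _).1 h
        refine ⟨a, ?_⟩
        rw [← shadow_withHeight (G t) (z t), ← shadow_smul, ha, shadow_withHeight]
      apply hne s hs t ht hst hc
      have := congrArg height h
      simpa only [hκ, height_mk] using this
    intro x y hxy
    obtain ⟨s, hs, rfl⟩ := exists_travel_eq o b x
    obtain ⟨t, ht, rfl⟩ := exists_travel_eq o b y
    rw [hlift, hlift] at hxy
    rcases lt_trichotomy s t with h | h | h
    · exact absurd hxy (hlt s hs t ht h)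
    · rw [h]
    · exact absurd hxy.symm (hlt t ht s hs h)
  · intro x
    obtain ⟨t, -, rfl⟩ := exists_travel_eq o b x
    change ProjectsTo ((hfper.lift : UnitAddCircle → RP 3) (travel o b t)) _
    rw [hlift]
    exact hproj t

/-! ### The descending knot and its diagram -/

theorem apply_add_int {ρ : ℝ → ℝ} (h : ∀ t, ρ (t + 1) = ρ t + 1) (t : ℝ) (n : ℤ) :
    ρ (t + n) = ρ t + n := by
  have hp : Function.Periodic (fun t => ρ t - t) 1 := fun t => by
    simp only [h]; ring
  have := hp.int_mul n t
  simp only [mul_one] at this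
  linarith

/-- Suitable crossing changes turn a diagram into a descending diagram of an unknot. -/
theorem exists_changeCrossings_descending (D : KnotDiagram) (o : ℤˣ) (b : UnitAddCircle)
    (hb : D.IsBasepoint b) :
    ∃ S : Finset (RP 2), (S : Set (RP 2)) ⊆ D.crossings ∧ (D.changeCrossings S).IsDescending o b ∧
      (D.changeCrossings S).IsDiagramOfUnknot := by
  obtain ⟨G, hG⟩ := exists_isUnitLift o hb
  obtain ⟨ε, hε, hper⟩ := hG.exists_period
  obtain ⟨τ, hτ0, hτ1, hlast⟩ := exists_last_crossing D o b
  obtain ⟨ρ, hρ, hρs, hmono, hρ1, hρ0, hρτ⟩ := exists_reparametrization hτ0 hτ1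
  have hρint := apply_add_int hρ1
  have hsymm1 : ∀ u, ρ.symm (u + 1) = ρ.symm u + 1 := by
    intro u
    rw [ρ.symm_apply_eq, hρ1, ρ.apply_symm_apply]
  have hρd : Differentiable ℝ ρ := hρ.differentiable (by simp)
  have hρsd : Differentiable ℝ ρ.symm := hρs.differentiable (by simp)
  have hGd : Differentiable ℝ G := hG.contDiff.differentiable (by simp)
  have hderiv : ∀ u, deriv ρ (ρ.symm u) * deriv ρ.symm u = 1 := by
    intro u
    have h1 := (hρd (ρ.symm u)).hasDerivAt.comp u (hρsd u).hasDerivAt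
    have h2 : (⇑ρ ∘ ⇑ρ.symm) = id := by ext x; simp
    rw [h2] at h1
    exact h1.unique (hasDerivAt_id u)
  have hcross : ∀ s ∈ Set.Ico (0 : ℝ) 1, ∀ t ∈ Set.Ico (0 : ℝ) 1, s ≠ t →
      D.curve (travel o b s) = D.curve (travel o b t) → 0 < s ∧ ρ s ∈ Set.Ioo (0 : ℝ) (1 / 2) := by
    intro s hs t ht hst hc
    have hmem : D.curve (travel o b s) ∈ D.crossings :=
      ⟨travel o b s, travel o b t, fun h => hst (travel_injOn o b hs ht h), rfl, hc.symm⟩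
    have hs0 : 0 < s := by
      refine lt_of_le_of_ne hs.1 ?_
      rintro rfl
      rw [travel_zero] at hmem
      exact hb.1 hmem
    refine ⟨hs0, ?_, ?_⟩
    · rw [← hρ0]; exact hmono hs0
    · exact (hmono.monotone (hlast s hs hmem)).trans_lt hρτ
  obtain ⟨ζ, hζ, hζ1, hanti, hζpos, hiso⟩ := exists_unknot_profile (F := fun u => G (ρ.symm u))
    (hGd.comp hρsd) (fun u => hG.nrm_eq _) hε (fun u => by rw [hsymm1, hper])
    (fun u => by
      have h1 : HasDerivAt (fun u => G (ρ.symm u)) _ u :=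
        (hGd (ρ.symm u)).hasDerivAt.scomp u (hρsd u).hasDerivAt
      rw [h1.deriv]
      refine linearIndependent_pair_of_combination (hG.immersion (ρ.symm u)) 1 0 0
        (deriv ρ.symm u) (by module) (by module) ?_
      have : deriv ρ.symm u ≠ 0 := right_ne_zero_of_mul_eq_one (hderiv u)
      simpa using this)
    -- The parameter `-u` is passed at `1 - u`, in `(1/2, 1)`. If `F u` and `F (-u)` were
    -- proportional, a crossing would be passed there, against the choice of `ρ`.
    (fun u hu => by
      refine hG.linearIndependent_of_ne fun h => ?_
      have hs : ρ.symm u ∈ Set.Ico (0 : ℝ) 1 := by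
        constructor
        · rw [← hmono.le_iff_le, hρ0, ρ.apply_symm_apply]; exact hu.1.le
        · rw [← hmono.lt_iff_lt, ρ.apply_symm_apply]
          have := hρ1 0
          rw [zero_add, hρ0, zero_add] at this
          rw [this]
          linarith [hu.2]
      have ht : ρ.symm (-u) + 1 ∈ Set.Ico (0 : ℝ) 1 := by
        rw [← hsymm1]
        constructor
        · rw [← hmono.le_iff_le, hρ0, ρ.apply_symm_apply]; linarith [hu.2]
        · rw [← hmono.lt_iff_lt, ρ.apply_symm_apply]
          have := hρ1 0
          rw [zero_add, hρ0, zero_add] at this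
          rw [this]
          linarith [hu.1]
      rw [← travel_add_one o b (ρ.symm (-u))] at h
      have hne : ρ.symm (-u) + 1 ≠ ρ.symm u := by
        intro he
        rw [← hsymm1] at he
        have := ρ.symm.injective he
        linarith [hu.2]
      have := (hcross _ ht _ hs hne h.symm).2.2
      rw [hρ1, ρ.apply_symm_apply] at this
      linarith [hu.2])
  have hpair : ∀ s ∈ Set.Ico (0 : ℝ) 1, ∀ t ∈ Set.Ico (0 : ℝ) 1, s < t →
      D.curve (travel o b s) = D.curve (travel o b t) →
      G s 2 ≠ 0 ∧ ((0 < G s 2 ∧ ζ (ρ t) / G t 2 < ζ (ρ s) / G s 2) ∨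
        (G s 2 < 0 ∧ ζ (ρ s) / G s 2 < ζ (ρ t) / G t 2)) := by
    intro s hs t ht hst hc
    have hρs := (hcross s hs t ht hst.ne hc).2
    have hρt := (hcross t ht s hs hst.ne' hc.symm).2
    have hlt : ζ (ρ t) < ζ (ρ s) := hanti hρs hρt (hmono hst)
    have hpos := hζpos _ hρt
    have hw : G s 2 ≠ 0 := by
      rw [Ne, ← hG.mem_lineAtInfinity_iff s]
      exact D.generic.notMem_lineAtInfinity _ ⟨travel o b s, travel o b t,
        fun h => hst.ne (travel_injOn o b hs ht h), rfl, hc.symm⟩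
    obtain ⟨e, he, hGe⟩ := hG.eq_or_eq_neg hc.symm
    have hcoord : ζ (ρ t) / G t 2 = (e * ζ (ρ t)) / G s 2 := by
      rw [hGe]
      rcases he with rfl | rfl
      · simp
      · simp [div_neg, neg_div]
    -- For `e = 1` this is the monotonicity of `ζ`; for `e = -1` its positivity is what counts.
    have hlt' : e * ζ (ρ t) < ζ (ρ s) := by
      rcases he with rfl | rfl <;> linarith
    refine ⟨hw, ?_⟩
    rw [hcoord]
    rcases lt_or_gt_of_ne hw with h | h
    · exact Or.inr ⟨h, (div_lt_div_right_of_neg h).2 hlt'⟩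
    · exact Or.inl ⟨h, (div_lt_div_iff_of_pos_right h).2 hlt'⟩
  obtain ⟨K, hKproj, hK⟩ := hG.exists_knot hper (z := fun t => ζ (ρ t)) (hζ.comp hρ)
    (fun t => by rw [hρ1, hζ1]) (fun s hs t ht hst hc => by
      rcases (hpair s hs t ht hst hc).2 with h | h
      · exact h.2.ne'
      · exact h.2.ne)
  have hheight : ∀ t, height (K.toFun (travel o b t)) = ζ (ρ t) / G t 2 := fun t => by
    rw [hK, height_mk]
  have hrange : Set.range K.toFun = pointsOf {v | ∃ u ∈ Set.Icc (-(1 / 2) : ℝ) (1 / 2),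
      v = withHeight (G (ρ.symm u)) (ζ u)} := by
    refine Set.Subset.antisymm ?_ ?_
    · rintro _ ⟨x, rfl⟩
      obtain ⟨t, -, rfl⟩ := exists_travel_eq o b x
      -- Subtracting the nearest integer brings `ρ` into `[-1/2, 1/2]` without moving the point on
      -- the circle.
      set s : ℝ := t + (-round (ρ t) : ℤ) with hs
      have hts : travel o b t = travel o b s :=
        ((travel_eq_travel_iff o b s t).2 ⟨_, hs⟩).symm
      rw [hts, hK]
      refine ⟨_, _, ⟨ρ s, ?_, ?_⟩, rfl⟩
      · rw [hs, hρint, Int.cast_neg, ← sub_eq_add_neg]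
        exact abs_le.1 (abs_sub_round (ρ t))
      · rw [ρ.symm_apply_apply]
    · rintro _ ⟨_, hv, ⟨u, -, rfl⟩, rfl⟩
      refine ⟨travel o b (ρ.symm u), ?_⟩
      rw [hK]
      simp only [ρ.apply_symm_apply]
  obtain ⟨S, hS, hdiag⟩ := exists_changeCrossings_isDiagramOf D K hKproj (by
    have hlt : ∀ s ∈ Set.Ico (0 : ℝ) 1, ∀ t ∈ Set.Ico (0 : ℝ) 1, s < t →
        D.curve (travel o b s) = D.curve (travel o b t) →
        height (K.toFun (travel o b s)) ≠ height (K.toFun (travel o b t)) := by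
      intro s hs t ht hst hc
      rw [hheight, hheight]
      rcases (hpair s hs t ht hst hc).2 with h | h
      · exact h.2.ne'
      · exact h.2.ne
    intro x y hxy hc
    obtain ⟨s, hs, rfl⟩ := exists_travel_eq o b x
    obtain ⟨t, ht, rfl⟩ := exists_travel_eq o b y
    rcases lt_trichotomy s t with h | h | h
    · exact hlt s hs t ht h hc
    · exact absurd (by rw [h]) hxy
    · exact (hlt t ht s hs h hc.symm).symm)
  refine ⟨S, hS, ?_, K, hdiag, ?_⟩
  · intro s t hs0 hst ht1 hc
    have hs : s ∈ Set.Ico (0 : ℝ) 1 := ⟨hs0.le, by linarith⟩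
    have ht : t ∈ Set.Ico (0 : ℝ) 1 := ⟨by linarith, ht1⟩
    have hne : travel o b s ≠ travel o b t := fun h => hst.ne (travel_injOn o b hs ht h)
    have hover := hdiag.2 _ _ hne hc
    rw [hheight, hheight] at hover
    obtain ⟨hw, hcase⟩ := hpair s hs t ht hst hc
    -- Crossing changes keep the curve, so the arc distance is that of `D`.
    have heven : Even ((D.changeCrossings S).arcDistance o b s) ↔ 0 < G s 2 :=
      hG.even_arcDistance_iff hs0 hw
    rw [hover, ← Nat.not_even_iff_odd, heven]
    rcases hcase with h | h
    · exact ⟨fun _ => h.2, fun h' => absurd h.1 h'⟩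
    · exact ⟨fun h' => absurd h' h.1.le.not_gt, fun _ => h.2.le.not_gt⟩
  · rw [Knot.IsUnknot, hrange]
    exact hiso

end ProjKnot

end

theorem mainTheorem5 (D : ProjKnot.KnotDiagram) :
    (∃ S : Finset (ProjKnot.RP 2), (S : Set (ProjKnot.RP 2)) ⊆ D.crossings ∧
      (D.changeCrossings S).IsDiagramOfUnknot) ∧
    ∀ (o : ℤˣ) (b : UnitAddCircle), D.IsBasepoint b →
      ∃ S : Finset (ProjKnot.RP 2), (S : Set (ProjKnot.RP 2)) ⊆ D.crossings ∧
        (D.changeCrossings S).IsDescending o b ∧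
        (D.changeCrossings S).IsDiagramOfUnknot := by
  refine ⟨?_, fun o b hb => ProjKnot.exists_changeCrossings_descending D o b hb⟩
  obtain ⟨b, hb⟩ := ProjKnot.exists_isBasepoint D
  obtain ⟨S, hS, -, hU⟩ := ProjKnot.exists_changeCrossings_descending D 1 b hb
  exact ⟨S, hS, hU⟩
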